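/- \textbf{Setting.} All quantities may vary along an arbitrary regime in which $v\to\infty$ and $T\to\infty$ jointly; constants called absolute do not vary. Let $n=n_1\cdots n_v$, where $n_1,\dots,n_v$ are integers with $2\le n_j\le N$ for an absolute constant $N$. Let $y_1,\dots,y_T$ be random vectors in $\mathbb R^n$ with common mean $\mu$ and common covariance matrix $$\Sigma=\sigma^2\,\Sigma_1\otimes\cdots\otimes\Sigma_v ,$$ where each $\Sigma_j$ is a symmetric positive semidefinite $n_j\times n_j$ matrix with $\operatorname{tr}\Sigma_j=n_j$, and $\sigma^2$ is bounded below by an absolute positive constant (in particular $\sigma^2$ may be a fixed positive number). Coordinates of $\mathbb R^n$ are labelled by multi-indices $(k_1,\dots,k_v)$, $1\le k_j\le n_j$, in lexicographic order. \textbf{Estimator.} Let $\bar y=\frac1T\sum_{t}y_t$ and $M_T=\frac1T\sum_{t}(y_t-\bar y)(y_t-\bar y)^{\intercal}$. For $1\le h\le v$ let $\hat d^{(h)}$ be the partial trace of $M_T$ onto the $h$-th factor, that is, the $n_h\times n_h$ matrix with entries $\hat d^{(h)}_{a,b}=\sum (M_T)_{k,k'}$, the sum over all pairs of multi-indices $k,k'$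 with $k_h=a$, $k'_h=b$ and $k_j=k'_j$ for $j\ne h$. Put $$\tilde\Sigma_h=\frac{\hat d^{(h)}}{\operatorname{tr}(\hat d^{(h)})/n_h},\qquad \hat\sigma^2=\frac{\operatorname{tr}M_T}{n},\qquad \tilde\Sigma=\hat\sigma^2\,\tilde\Sigma_1\otimes\cdots\otimes\tilde\Sigma_v .$$ \textbf{Assumptions.} (1) $y_1,\dots,y_T$ are independent, and for absolute positive constants $A,C$: $\max_{1\le i\le n}\frac1T\sum_{t=1}^T\mathbb E|y_{t,i}|^m\le m!\,A^m$ for $m=2,3,\dots$; and for every $t$, entry by entry, $\operatorname{var}\big((y_t-\mu)\otimes(y_t-\mu)\big)\le C\operatorname{var}\big((z-\mu)\otimes(z-\mu)\big)$, where $z\sim N(\mu,\Sigma)$. (2) $\min_{1\le j\le v}\lambda_{\min}(\Sigma_j)$ is eventually bounded below by an absolute positive constant. (3) For a fixed $\beta_1\in[0,2]$, $\|\Sigma\|_F^2/n^{\beta_1}\to\omega$ for some real $\omega$. \textbf{Theorem.} Suppose in addition that $\log^3 n/T\to0$. Then $\tilde\Sigma$ is invertible with probability tending to one, and for each of the norms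 $\|\cdot\|$ = Frobenius norm, elementwise $\ell_1$ norm ($\|A\|_1=\sum_{i,j}|a_{i,j}|$) and spectral norm, both relative errors $$\frac{\|\tilde\Sigma-\Sigma\|}{\|\Sigma\|}\qquad\text{and}\qquad\frac{\|\tilde\Sigma^{-1}-\Sigma^{-1}\|}{\|\Sigma^{-1}\|}$$ are $$O_p\!\left(\sqrt{\frac{\log^3 n}{n^{2-\beta_1}T}}\right)+O_p\!\left(\frac{\log^2 n}{T}\right),$$ and in particular converge to $0$ in probability. -/

import Mathlib

open MeasureTheory ProbabilityTheory Filter Topology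

noncomputable section

namespace KroneckerCov

/-- The label set of the coordinates of a vector of dimension `n 0 * ⋯ * n (v - 1)`: a coordinate is
labelled by its multi-index (the position in each of the `v` ways of the multiway data).  Listing
the multi-indices in lexicographic order gives the usual enumeration by `1, …, n`. -/
abbrev MultiIdx {v : ℕ} (n : Fin v → ℕ) : Type := (j : Fin v) → Fin (n j)

/-- The dimension `n = n_1 ⋯ n_v`. -/
def totalDim {v : ℕ} (n : Fin v → ℕ) : ℕ := ∏ j, n j

/-- The Kronecker product `S_1 ⊗ ⋯ ⊗ S_v`. -/
def kron {v : ℕ} {n : Fin v → ℕ} (S : (j : Fin v) → Matrix (Fin (n j)) (Fin (n j)) ℝ) :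
    Matrix (MultiIdx n) (MultiIdx n) ℝ :=
  Matrix.of fun a b => ∏ j, S j (a j) (b j)

/-- The Kronecker product covariance model `σ² × S_1 ⊗ ⋯ ⊗ S_v`. -/
def kronModel {v : ℕ} {n : Fin v → ℕ} (s2 : ℝ)
    (S : (j : Fin v) → Matrix (Fin (n j)) (Fin (n j)) ℝ) :
    Matrix (MultiIdx n) (MultiIdx n) ℝ :=
  s2 • kron S

/-- The partial trace onto the `h`-th way: the `(a, b)` entry is the trace of the block of `M` whose
row labels have `h`-th index `a` and whose column labels have `h`-th index `b`, that is, the sum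
of `M k k'` over all pairs `k, k'` with `k h = a`, `k' h = b` that agree outside `h`. -/
def partialTrace {v : ℕ} {n : Fin v → ℕ} (h : Fin v) (M : Matrix (MultiIdx n) (MultiIdx n) ℝ) :
    Matrix (Fin (n h)) (Fin (n h)) ℝ :=
  Matrix.of fun a b => ∑ k : MultiIdx n, if k h = a then M k (Function.update k h b) else 0

/-- The sample mean `ȳ` of `y_1, …, y_T`. -/
def sampleMean {ι : Type*} {T : ℕ} (y : Fin T → ι → ℝ) : ι → ℝ :=
  (T : ℝ)⁻¹ • ∑ t, y t

/-- The sample covariance matrix `M_T = T⁻¹ ∑ₜ (y_t - ȳ)(y_t - ȳ)ᵀ`. -/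
def sampleCov {ι : Type*} {T : ℕ} (y : Fin T → ι → ℝ) : Matrix ι ι ℝ :=
  (T : ℝ)⁻¹ • ∑ t, Matrix.vecMulVec (y t - sampleMean y) (y t - sampleMean y)

/-- The estimator of `σ²`: the trace of `M_T` divided by `n`. -/
def sigmaSqHat {v : ℕ} {n : Fin v → ℕ} {T : ℕ} (y : Fin T → MultiIdx n → ℝ) : ℝ :=
  (sampleCov y).trace / (totalDim n : ℝ)

/-- The estimator of the `h`-th factor: the partial trace of `M_T` onto the `h`-th way, rescaled so
that its trace is `n_h`. -/
def factorEst {v : ℕ} {n : Fin v → ℕ} {T : ℕ} (y : Fin T → MultiIdx n → ℝ) (h : Fin v) :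
    Matrix (Fin (n h)) (Fin (n h)) ℝ :=
  ((partialTrace h (sampleCov y)).trace / (n h : ℝ))⁻¹ • partialTrace h (sampleCov y)

/-- The quadratic form estimator of the covariance matrix. -/
def quadFormEst {v : ℕ} {n : Fin v → ℕ} {T : ℕ} (y : Fin T → MultiIdx n → ℝ) :
    Matrix (MultiIdx n) (MultiIdx n) ℝ :=
  sigmaSqHat y • kron (factorEst y)

/-- The Frobenius norm. -/
def frobNorm {ι : Type*} [Fintype ι] (A : Matrix ι ι ℝ) : ℝ :=
  Real.sqrt (A.transpose * A).trace

/-- The elementwise `ℓ₁` norm. -/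
def l1Norm {ι : Type*} [Fintype ι] (A : Matrix ι ι ℝ) : ℝ :=
  ∑ a, ∑ b, |A a b|

/-- The spectral norm: the operator norm for the Euclidean vector norm. -/
def specNorm {ι : Type*} [Fintype ι] [DecidableEq ι] (A : Matrix ι ι ℝ) : ℝ :=
  ‖Matrix.toEuclideanCLM (𝕜 := ℝ) A‖

/-- The relative error `‖A - B‖ / ‖B‖` of `A` as an approximation of `B`. -/
def relErr {ι : Type*} (nrm : Matrix ι ι ℝ → ℝ) (A B : Matrix ι ι ℝ) : ℝ :=
  nrm (A - B) / nrm B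

/-- The rate `√(log³ n / (n ^ (2 - β) T))`. -/
def rateAveraging (n : ℕ) (T : ℕ) (β : ℝ) : ℝ :=
  Real.sqrt (Real.log (n : ℝ) ^ 3 / ((n : ℝ) ^ (2 - β) * (T : ℝ)))

/-- The rate `log² n / T`. -/
def rateCentering (n : ℕ) (T : ℕ) : ℝ :=
  Real.log (n : ℝ) ^ 2 / (T : ℝ)

/-- `X = O_p(a)` along `l`, for random variables on possibly different probability spaces. -/
def IsBigOp {ι : Type*} {Ω : ι → Type*} [∀ i, MeasurableSpace (Ω i)]
    (P : ∀ i, Measure (Ω i)) (l : Filter ι) (X : ∀ i, Ω i → ℝ) (a : ι → ℝ) : Prop :=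
  ∀ ε : ℝ, 0 < ε → ∃ K : ℝ, 0 < K ∧
    ∀ᶠ i in l, P i {ω | K * a i < |X i ω|} ≤ ENNReal.ofReal ε

/-- `X = O_p(a) + O_p(b)` along `l`. -/
def IsBigOpSum {ι : Type*} {Ω : ι → Type*} [∀ i, MeasurableSpace (Ω i)]
    (P : ∀ i, Measure (Ω i)) (l : Filter ι) (X : ∀ i, Ω i → ℝ) (a b : ι → ℝ) : Prop :=
  ∃ U V : ∀ i, Ω i → ℝ, (∀ i ω, X i ω = U i ω + V i ω) ∧ IsBigOp P l U a ∧ IsBigOp P l V b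

/-- `X = o_p(1)` along `l`: convergence to zero in probability. -/
def IsLittleOpOne {ι : Type*} {Ω : ι → Type*} [∀ i, MeasurableSpace (Ω i)]
    (P : ∀ i, Measure (Ω i)) (l : Filter ι) (X : ∀ i, Ω i → ℝ) : Prop :=
  ∀ δ : ℝ, 0 < δ → Tendsto (fun i => P i {ω | δ < |X i ω|}) l (𝓝 0)

/-- Moment bounds of exponential type: all absolute moments of order `m ≥ 2` are finite and their
averages over `t` are at most `m! A ^ m` in every coordinate. -/
def MomentBound {Ω : Type*} [MeasurableSpace Ω] (P : Measure Ω) {ι : Type*} {T : ℕ}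
    (y : Fin T → Ω → ι → ℝ) (A : ℝ) : Prop :=
  ∀ (k : ι) (m : ℕ), 2 ≤ m →
    (∀ t, Integrable (fun ω => |y t ω k| ^ m) P) ∧
      (T : ℝ)⁻¹ * ∑ t, ∫ ω, |y t ω k| ^ m ∂P ≤ (m.factorial : ℝ) * A ^ m

/-- Componentwise domination of the kurtosis matrix: with `μ` the mean and `V` the covariance matrix
of the random vector `x`, and `z` a normal random vector with the same mean and covariance matrix,
`var((x - μ) ⊗ (x - μ)) ≤ C var((z - μ) ⊗ (z - μ))` entry by entry. -/
def KurtosisDominated {Ω : Type*} [MeasurableSpace Ω] (P : Measure Ω) {ι : Type*} [Fintype ι]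
    [DecidableEq ι] (x : Ω → ι → ℝ) (μ : ι → ℝ) (V : Matrix ι ι ℝ) (C : ℝ) : Prop :=
  ∀ a b c d : ι,
    cov[fun ω => (x ω a - μ a) * (x ω b - μ b), fun ω => (x ω c - μ c) * (x ω d - μ d); P] ≤
      C * cov[fun z => (z a - μ a) * (z b - μ b), fun z => (z c - μ c) * (z d - μ d);
        multivariateGaussian (WithLp.toLp 2 μ) V]

end KroneckerCov

end

/-!
The proof is elementary: a second moment bound for each partial trace, Markov's inequality, and a
multiplicative perturbation argument for Kronecker products.

*Reduction to the factors.* Write `Σ = σ² S_1 ⊗ ⋯ ⊗ S_v` and `Δ_h = (n_h / (n σ²)) D_h - S_h`,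
where `D_h` is the partial trace of the sample covariance matrix onto the `h`-th way.  All the `D_h`
have the same trace, so `δ = tr Δ_h / n_h` does not depend on `h`, and the estimator is
`σ² (1 + δ) ⊗_h (S_h + Δ_h) / (1 + δ)`.  Since the eigenvalues of `S_h` are bounded below, this is
`Σ (1 + R)` where the absolute row and column sums of `R` are at most a constant times `∑_h ‖Δ_h‖₁`
as soon as this sum is small (`exists_quadFormEst_eq_mul_one_add`): row sums are multiplicative
under Kronecker products, and `∏ (1 + g_h) - 1 ≤ 2 ∑ g_h` for small `g_h`.

*Norms.* By the Schur test, a matrix with absolute row and column sums at most `r` multiplies the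
Frobenius, the elementwise `ℓ₁` and the spectral norm by at most `r`, from either side.  Hence the
relative error of `Σ (1 + R)` is at most `r`.  For `r < 1` the matrix `1 + R` is invertible, and
`(1 + R)⁻¹ - 1` has row and column sums at most `r / (1 - r)`, as for a Neumann series; this bounds
the relative error of the inverse (`relErr_le_of_eq_mul_one_add`).

*Probability.* With `w = ȳ - μ`, the sample covariance matrix is the average of
`(y_t - μ)(y_t - μ)ᵀ` minus `w wᵀ`.  An entry of a partial trace of the average is an average of
independent quadratic forms.  The kurtosis condition compares their variances with those for a
Gaussian vector, which Isserlis' formula bounds by `2 ‖Σ‖_F²` (`variance_sum_mul_le`), and the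
centering term has expectation of order `tr Σ / T = n σ² / T`.  Summing the expectations over the
`v` ways and using `v ≤ 2 log n` gives the two rates
(`exists_integrable_bound_partialTrace`, `mul_sqrt_add_le_rates`).  As only the sum of the errors
over the ways enters, no maximal inequality is needed.
-/

noncomputable section

namespace KroneckerCov

open scoped Matrix MatrixOrder NNReal

/-! ### Matrices with bounded absolute row and column sums -/

/-- All absolute row sums and all absolute column sums of `B` are at most `r`; by the Schur test `B`
is then bounded by `r` as an operator for the Euclidean norm. -/
structure SchurBound {ι : Type*} [Fintype ι] (B : Matrix ι ι ℝ) (r : ℝ) : Prop where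
  nonneg : 0 ≤ r
  row : ∀ a, ∑ b, |B a b| ≤ r
  col : ∀ b, ∑ a, |B a b| ≤ r

section Schur

variable {ι : Type*} [Fintype ι]

lemma SchurBound.transpose {B : Matrix ι ι ℝ} {r : ℝ} (h : SchurBound B r) :
    SchurBound B.transpose r :=
  ⟨h.nonneg, h.col, h.row⟩

lemma SchurBound.mono {B : Matrix ι ι ℝ} {r s : ℝ} (h : SchurBound B r) (hrs : r ≤ s) :
    SchurBound B s :=
  ⟨h.nonneg.trans hrs, fun a => (h.row a).trans hrs, fun a => (h.col a).trans hrs⟩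

lemma SchurBound.add {A B : Matrix ι ι ℝ} {r s : ℝ} (hA : SchurBound A r) (hB : SchurBound B s) :
    SchurBound (A + B) (r + s) where
  nonneg := add_nonneg hA.nonneg hB.nonneg
  row a := (Finset.sum_le_sum fun b _ => abs_add_le (A a b) (B a b)).trans <| by
    rw [Finset.sum_add_distrib]; exact add_le_add (hA.row a) (hB.row a)
  col b := (Finset.sum_le_sum fun a _ => abs_add_le (A a b) (B a b)).trans <| by
    rw [Finset.sum_add_distrib]; exact add_le_add (hA.col b) (hB.col b)

lemma SchurBound.smul {B : Matrix ι ι ℝ} {r : ℝ} (h : SchurBound B r) (x : ℝ) :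
    SchurBound (x • B) (|x| * r) where
  nonneg := mul_nonneg (abs_nonneg x) h.nonneg
  row a := by
    simp only [Matrix.smul_apply, smul_eq_mul, abs_mul, ← Finset.mul_sum]
    exact mul_le_mul_of_nonneg_left (h.row a) (abs_nonneg x)
  col a := by
    simp only [Matrix.smul_apply, smul_eq_mul, abs_mul, ← Finset.mul_sum]
    exact mul_le_mul_of_nonneg_left (h.col a) (abs_nonneg x)

lemma schurBound_one [DecidableEq ι] : SchurBound (1 : Matrix ι ι ℝ) 1 where
  nonneg := zero_le_one
  row a := by simp [Matrix.one_apply, apply_ite abs]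
  col a := by simp [Matrix.one_apply, apply_ite abs]

lemma l1Norm_nonneg (A : Matrix ι ι ℝ) : 0 ≤ l1Norm A :=
  Finset.sum_nonneg fun _ _ => Finset.sum_nonneg fun _ _ => abs_nonneg _

lemma schurBound_l1Norm (A : Matrix ι ι ℝ) : SchurBound A (l1Norm A) where
  nonneg := l1Norm_nonneg A
  row a := Finset.single_le_sum (f := fun a => ∑ b, |A a b|)
    (fun _ _ => Finset.sum_nonneg fun _ _ => abs_nonneg _) (Finset.mem_univ a)
  col b := by
    rw [l1Norm, Finset.sum_comm]
    exact Finset.single_le_sum (f := fun b => ∑ a, |A a b|)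
      (fun _ _ => Finset.sum_nonneg fun _ _ => abs_nonneg _) (Finset.mem_univ b)

lemma abs_trace_le_l1Norm (A : Matrix ι ι ℝ) : |A.trace| ≤ l1Norm A :=
  (Finset.abs_sum_le_sum_abs _ _).trans <| Finset.sum_le_sum fun a _ =>
    Finset.single_le_sum (f := fun b => |A a b|) (fun _ _ => abs_nonneg _) (Finset.mem_univ a)

lemma l1Norm_mul_le {A B : Matrix ι ι ℝ} {r : ℝ} (hB : SchurBound B r) :
    l1Norm (A * B) ≤ l1Norm A * r := by
  unfold l1Norm
  rw [Finset.sum_mul]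
  refine Finset.sum_le_sum fun a _ => ?_
  calc ∑ b, |(A * B) a b| ≤ ∑ b, ∑ k, |A a k| * |B k b| := by
        refine Finset.sum_le_sum fun b _ => ?_
        rw [Matrix.mul_apply]
        simpa only [abs_mul] using Finset.abs_sum_le_sum_abs (fun k => A a k * B k b) Finset.univ
    _ = ∑ k, |A a k| * ∑ b, |B k b| := by
        rw [Finset.sum_comm]; simp only [Finset.mul_sum]
    _ ≤ ∑ k, |A a k| * r := Finset.sum_le_sum fun k _ =>
        mul_le_mul_of_nonneg_left (hB.row k) (abs_nonneg _)
    _ = (∑ k, |A a k|) * r := by rw [Finset.sum_mul]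

lemma l1Norm_transpose (A : Matrix ι ι ℝ) : l1Norm A.transpose = l1Norm A := by
  unfold l1Norm
  rw [Finset.sum_comm]
  rfl

/-- The Schur test. -/
lemma SchurBound.sum_sq_mulVec_le {B : Matrix ι ι ℝ} {r : ℝ} (hB : SchurBound B r) (x : ι → ℝ) :
    ∑ a, (B.mulVec x a) ^ 2 ≤ r ^ 2 * ∑ b, x b ^ 2 := by
  have h1 : ∀ a, (B.mulVec x a) ^ 2 ≤ r * ∑ b, |B a b| * x b ^ 2 := by
    intro a
    have hcs := Finset.sum_sq_le_sum_mul_sum_of_sq_le_mul Finset.univ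
      (r := fun b => |B a b| * |x b|) (f := fun b => |B a b|) (g := fun b => |B a b| * x b ^ 2)
      (fun b _ => abs_nonneg _) (fun b _ => by positivity)
      (fun b _ => le_of_eq (by rw [mul_pow, sq_abs (x b)]; ring))
    have h2 : (B.mulVec x a) ^ 2 ≤ (∑ b, |B a b| * |x b|) ^ 2 := by
      rw [← sq_abs]
      refine pow_le_pow_left₀ (abs_nonneg _) ?_ 2
      simpa only [abs_mul] using! Finset.abs_sum_le_sum_abs (fun b => B a b * x b) Finset.univ
    exact h2.trans <| hcs.trans <| mul_le_mul_of_nonneg_right (hB.row a)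
      (Finset.sum_nonneg fun b _ => by positivity)
  calc ∑ a, (B.mulVec x a) ^ 2 ≤ ∑ a, r * ∑ b, |B a b| * x b ^ 2 :=
        Finset.sum_le_sum fun a _ => h1 a
    _ = r * ∑ b, (∑ a, |B a b|) * x b ^ 2 := by
        rw [← Finset.mul_sum, Finset.sum_comm]; simp only [Finset.sum_mul]
    _ ≤ r * ∑ b, r * x b ^ 2 := by
        refine mul_le_mul_of_nonneg_left (Finset.sum_le_sum fun b _ => ?_) hB.nonneg
        exact mul_le_mul_of_nonneg_right (hB.col b) (sq_nonneg _)
    _ = r ^ 2 * ∑ b, x b ^ 2 := by rw [← Finset.mul_sum]; ring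

lemma trace_transpose_mul_self (A : Matrix ι ι ℝ) :
    (A.transpose * A).trace = ∑ a, ∑ b, A a b ^ 2 := by
  rw [Finset.sum_comm]
  simp [Matrix.trace, Matrix.mul_apply, sq]

lemma frobNorm_sq (A : Matrix ι ι ℝ) : frobNorm A ^ 2 = ∑ a, ∑ b, A a b ^ 2 := by
  rw [frobNorm, trace_transpose_mul_self, Real.sq_sqrt (by positivity)]

lemma frobNorm_nonneg (A : Matrix ι ι ℝ) : 0 ≤ frobNorm A := Real.sqrt_nonneg _

lemma frobNorm_transpose (A : Matrix ι ι ℝ) : frobNorm A.transpose = frobNorm A := by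
  rw [← sq_eq_sq₀ (frobNorm_nonneg _) (frobNorm_nonneg _), frobNorm_sq, frobNorm_sq,
    Finset.sum_comm]
  rfl

lemma frobNorm_mul_le {A B : Matrix ι ι ℝ} {r : ℝ} (hB : SchurBound B r) :
    frobNorm (A * B) ≤ frobNorm A * r := by
  refine le_of_sq_le_sq ?_ (mul_nonneg (frobNorm_nonneg A) hB.nonneg)
  rw [mul_pow, frobNorm_sq, frobNorm_sq, Finset.sum_mul]
  refine Finset.sum_le_sum fun a _ => ?_
  have h := hB.transpose.sum_sq_mulVec_le (fun k => A a k)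
  rw [mul_comm]
  refine le_trans (le_of_eq (Finset.sum_congr rfl fun b _ => ?_)) h
  simp [Matrix.mul_apply, Matrix.mulVec, dotProduct, mul_comm]

lemma SchurBound.specNorm_le [DecidableEq ι] {B : Matrix ι ι ℝ} {r : ℝ} (hB : SchurBound B r) :
    specNorm B ≤ r := by
  refine ContinuousLinearMap.opNorm_le_bound _ hB.nonneg fun x => ?_
  refine le_of_sq_le_sq ?_ (mul_nonneg hB.nonneg (norm_nonneg x))
  rw [mul_pow, EuclideanSpace.norm_sq_eq, EuclideanSpace.norm_sq_eq]
  simpa using! hB.sum_sq_mulVec_le x.ofLp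

/-- A nonnegative function on matrices which, like the Frobenius, the elementwise `ℓ₁` and the
spectral norm, grows at most by the factor `r` under multiplication, on either side, by a matrix
whose absolute row and column sums are at most `r`. -/
structure IsSchurIdealNorm (nrm : Matrix ι ι ℝ → ℝ) : Prop where
  nonneg : ∀ A, 0 ≤ nrm A
  mul_right : ∀ A B r, SchurBound B r → nrm (A * B) ≤ nrm A * r
  mul_left : ∀ A B r, SchurBound B r → nrm (B * A) ≤ nrm A * r

lemma isSchurIdealNorm_l1Norm : IsSchurIdealNorm (l1Norm (ι := ι)) where
  nonneg := l1Norm_nonneg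
  mul_right _ _ _ hB := l1Norm_mul_le hB
  mul_left A B r hB := by
    rw [← l1Norm_transpose, Matrix.transpose_mul, ← l1Norm_transpose A]
    exact l1Norm_mul_le hB.transpose

lemma isSchurIdealNorm_frobNorm : IsSchurIdealNorm (frobNorm (ι := ι)) where
  nonneg := frobNorm_nonneg
  mul_right _ _ _ hB := frobNorm_mul_le hB
  mul_left A B r hB := by
    rw [← frobNorm_transpose, Matrix.transpose_mul, ← frobNorm_transpose A]
    exact frobNorm_mul_le hB.transpose

lemma specNorm_mul_le [DecidableEq ι] (A B : Matrix ι ι ℝ) :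
    specNorm (A * B) ≤ specNorm A * specNorm B := by
  unfold specNorm
  rw [map_mul]
  exact norm_mul_le _ _

lemma isSchurIdealNorm_specNorm [DecidableEq ι] : IsSchurIdealNorm (specNorm (ι := ι)) where
  nonneg _ := norm_nonneg _
  mul_right A B _ hB := (specNorm_mul_le A B).trans <|
    mul_le_mul_of_nonneg_left hB.specNorm_le (norm_nonneg _)
  mul_left A B _ hB := (specNorm_mul_le B A).trans <| by
    rw [mul_comm]; exact mul_le_mul_of_nonneg_left hB.specNorm_le (norm_nonneg _)

variable [DecidableEq ι]

lemma SchurBound.isUnit_one_add {R : Matrix ι ι ℝ} {r : ℝ} (hR : SchurBound R r) (hr : r < 1) :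
    IsUnit (1 + R) := by
  rw [Matrix.isUnit_iff_isUnit_det, isUnit_iff_ne_zero]
  intro h0
  obtain ⟨x, hx0, hx⟩ := Matrix.exists_mulVec_eq_zero_iff.mpr h0
  have h1 : x = -R.mulVec x := by
    rw [Matrix.add_mulVec, Matrix.one_mulVec] at hx
    exact eq_neg_of_add_eq_zero_left hx
  have h2 := hR.sum_sq_mulVec_le x
  have h3 : ∑ a, (R.mulVec x a) ^ 2 = ∑ a, x a ^ 2 := by
    refine Finset.sum_congr rfl fun a _ => ?_
    conv_rhs => rw [h1]
    simp
  have h4 : 0 < ∑ a, x a ^ 2 := by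
    obtain ⟨a, ha⟩ := Function.ne_iff.mp hx0
    exact Finset.sum_pos' (fun _ _ => sq_nonneg _) ⟨a, Finset.mem_univ a, by
      have : x a ≠ 0 := ha
      positivity⟩
  have h5 : r ^ 2 < 1 := by
    have := hR.nonneg
    nlinarith
  rw [h3] at h2
  nlinarith

lemma SchurBound.row_inv_one_add_sub_one {R : Matrix ι ι ℝ} {r : ℝ} (hR : SchurBound R r)
    (hr : r < 1) (a : ι) : ∑ b, |((1 + R)⁻¹ - 1) a b| ≤ r / (1 - r) := by
  set E := (1 + R)⁻¹ - 1 with hE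
  have hu := (Matrix.isUnit_iff_isUnit_det _).mp (hR.isUnit_one_add hr)
  have hEq : E = -R - R * E := by
    have h1 : (1 + R) * (E + 1) = 1 := by rw [hE, sub_add_cancel, Matrix.mul_nonsing_inv _ hu]
    rw [add_mul, one_mul, mul_add, mul_one] at h1
    have h2 : E + (R * E + R) = 0 := by
      have : E + (R * E + R) + 1 = 0 + 1 := by rw [zero_add, add_right_comm, h1]
      exact add_right_cancel this
    rw [neg_sub_left, ← sub_eq_zero, sub_neg_eq_add, h2]
  -- a row of maximal absolute sum
  obtain ⟨m, -, hm⟩ := Finset.exists_max_image Finset.univ (fun a => ∑ b, |E a b|)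
    ⟨a, Finset.mem_univ a⟩
  have key : ∑ b, |E m b| ≤ r + r * ∑ b, |E m b| := by
    calc ∑ b, |E m b| ≤ ∑ b, (|R m b| + ∑ k, |R m k| * |E k b|) := by
          refine Finset.sum_le_sum fun b _ => ?_
          nth_rewrite 1 [hEq]
          rw [Matrix.sub_apply, Matrix.neg_apply, Matrix.mul_apply]
          refine (abs_sub _ _).trans (add_le_add (by rw [abs_neg]) ?_)
          simpa only [abs_mul] using Finset.abs_sum_le_sum_abs (fun k => R m k * E k b) Finset.univ
      _ = ∑ b, |R m b| + ∑ k, |R m k| * ∑ b, |E k b| := by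
          rw [Finset.sum_add_distrib, Finset.sum_comm (s := Finset.univ)]
          simp only [Finset.mul_sum]
      _ ≤ r + ∑ k, |R m k| * ∑ b, |E m b| := by
          refine add_le_add (hR.row m) (Finset.sum_le_sum fun k _ => ?_)
          exact mul_le_mul_of_nonneg_left (hm k (Finset.mem_univ k)) (abs_nonneg _)
      _ ≤ r + r * ∑ b, |E m b| := by
          rw [← Finset.sum_mul]
          gcongr
          exact hR.row m
  refine (hm a (Finset.mem_univ a)).trans ?_
  rw [le_div_iff₀ (by linarith)]
  linarith

/-- Neumann series bound for the inverse of a small perturbation of the identity. -/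
lemma SchurBound.inv_one_add_sub_one {R : Matrix ι ι ℝ} {r : ℝ} (hR : SchurBound R r)
    (hr : r < 1) : SchurBound ((1 + R)⁻¹ - 1) (r / (1 - r)) where
  nonneg := div_nonneg hR.nonneg (by linarith)
  row := hR.row_inv_one_add_sub_one hr
  col b := by
    have h := hR.transpose.row_inv_one_add_sub_one hr b
    have h2 : (1 + R.transpose)⁻¹ - 1 = ((1 + R)⁻¹ - 1).transpose := by
      rw [Matrix.transpose_sub, Matrix.transpose_nonsing_inv, Matrix.transpose_add,
        Matrix.transpose_one]
    rw [h2] at h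
    exact h

/-- If `A = B (1 + R)` with a small `R`, then the relative errors of `A` and of `A⁻¹` are small.  No
invertibility is assumed: `A⁻¹ = (1 + R)⁻¹ B⁻¹` holds for Mathlib's total inverse, and the quotient
`relErr` is `0` when its denominator is. -/
lemma relErr_le_of_eq_mul_one_add {nrm : Matrix ι ι ℝ → ℝ} (hn : IsSchurIdealNorm nrm)
    {A B R : Matrix ι ι ℝ} {r : ℝ} (hR : SchurBound R r) (hr : r ≤ 1 / 2) (hA : A = B * (1 + R)) :
    relErr nrm A B ≤ 2 * r ∧ relErr nrm A⁻¹ B⁻¹ ≤ 2 * r := by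
  have h0 := hR.nonneg
  constructor
  · refine div_le_of_le_mul₀ (hn.nonneg _) (by linarith) ?_
    have h1 : A - B = B * R := by rw [hA, mul_add, mul_one]; abel
    rw [h1]
    have h2 := hn.mul_right B R r hR
    have := hn.nonneg B
    nlinarith
  · refine div_le_of_le_mul₀ (hn.nonneg _) (by linarith) ?_
    have h1 : A⁻¹ - B⁻¹ = ((1 + R)⁻¹ - 1) * B⁻¹ := by
      rw [hA, Matrix.mul_inv_rev, sub_mul, one_mul]
    rw [h1]
    have h2 := hn.mul_left B⁻¹ _ _ (hR.inv_one_add_sub_one (by linarith))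
    have h3 : r / (1 - r) ≤ 2 * r := by
      rw [div_le_iff₀ (by linarith)]; nlinarith
    have := hn.nonneg B⁻¹
    nlinarith

end Schur

/-! ### Kronecker products -/

section Kron

variable {v : ℕ} {n : Fin v → ℕ}

lemma kron_mul (A B : (j : Fin v) → Matrix (Fin (n j)) (Fin (n j)) ℝ) :
    kron A * kron B = kron fun j => A j * B j := by
  ext a b
  simp only [kron, Matrix.mul_apply, Matrix.of_apply, ← Finset.prod_mul_distrib]
  rw [Fintype.prod_sum]

lemma kron_one : kron (fun j => (1 : Matrix (Fin (n j)) (Fin (n j)) ℝ)) = 1 := by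
  ext a b
  simp only [kron, Matrix.of_apply]
  by_cases h : a = b
  · subst h; simp
  · obtain ⟨j, hj⟩ := Function.ne_iff.mp h
    rw [Matrix.one_apply_ne h]
    exact Finset.prod_eq_zero (Finset.mem_univ j) (Matrix.one_apply_ne hj)

lemma posSemidef_kron {S : (j : Fin v) → Matrix (Fin (n j)) (Fin (n j)) ℝ}
    (hS : ∀ j, (S j).PosSemidef) : (kron S).PosSemidef := by
  choose B hB using fun j => CStarAlgebra.nonneg_iff_eq_star_mul_self.mp (hS j).nonneg
  have h : kron S = (kron B).conjTranspose * kron B := by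
    have h1 : (kron B).conjTranspose = kron fun j => (B j).conjTranspose := by
      ext a b; simp [kron]
    rw [h1, kron_mul]
    exact congrArg kron (funext hB)
  rw [h]
  exact Matrix.posSemidef_conjTranspose_mul_self _

lemma trace_kron (S : (j : Fin v) → Matrix (Fin (n j)) (Fin (n j)) ℝ) :
    (kron S).trace = ∏ j, (S j).trace := by
  simp only [Matrix.trace, kron, Matrix.diag_apply, Matrix.of_apply]
  rw [Fintype.prod_sum]

/-- In the expanded product, every term with at least one factor `y j` is bounded by its absolute
value. -/
lemma abs_prod_add_sub_prod_le {κ : Type*} (s : Finset κ) (x y : κ → ℝ) :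
    |∏ j ∈ s, (x j + y j) - ∏ j ∈ s, x j| ≤ ∏ j ∈ s, (|x j| + |y j|) - ∏ j ∈ s, |x j| := by
  classical
  induction s using Finset.induction_on with
  | empty => simp
  | insert j s hj ih =>
    simp only [Finset.prod_insert hj]
    set p := ∏ j ∈ s, (x j + y j)
    set q := ∏ j ∈ s, x j with hq
    have hp : |p| ≤ ∏ j ∈ s, (|x j| + |y j|) := by
      rw [Finset.abs_prod]
      exact Finset.prod_le_prod (fun _ _ => abs_nonneg _) fun j _ => abs_add_le _ _
    rw [← Finset.abs_prod] at ih ⊢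
    calc |(x j + y j) * p - x j * q| = |x j * (p - q) + y j * p| := by ring_nf
      _ ≤ |x j| * |p - q| + |y j| * |p| := by
          rw [← abs_mul, ← abs_mul]; exact abs_add_le _ _
      _ ≤ |x j| * (∏ j ∈ s, (|x j| + |y j|) - |q|) + |y j| * ∏ j ∈ s, (|x j| + |y j|) := by
          gcongr
      _ = _ := by ring

/-- Absolute row sums are multiplicative under Kronecker products, and `1` has row sums `1`. -/
lemma sum_abs_kron_one_add_sub_one_le {G : (j : Fin v) → Matrix (Fin (n j)) (Fin (n j)) ℝ}
    {g : Fin v → ℝ} (a : MultiIdx n) (hG : ∀ j, ∑ b, |G j (a j) b| ≤ g j) :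
    ∑ b, |(kron (fun j => 1 + G j) - 1) a b| ≤ ∏ j, (1 + g j) - 1 := by
  have h1 : ∀ b : MultiIdx n, |(kron (fun j => 1 + G j) - 1) a b| ≤
      ∏ j, ((1 : Matrix (Fin (n j)) (Fin (n j)) ℝ) (a j) (b j) + |G j (a j) (b j)|) -
        ∏ j, (1 : Matrix (Fin (n j)) (Fin (n j)) ℝ) (a j) (b j) := by
    intro b
    have h := abs_prod_add_sub_prod_le Finset.univ
      (fun j => (1 : Matrix (Fin (n j)) (Fin (n j)) ℝ) (a j) (b j)) (fun j => G j (a j) (b j))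
    have h2 : ∀ j, |(1 : Matrix (Fin (n j)) (Fin (n j)) ℝ) (a j) (b j)| =
        (1 : Matrix (Fin (n j)) (Fin (n j)) ℝ) (a j) (b j) := fun j => by
      rw [Matrix.one_apply]; split_ifs <;> simp
    simp only [h2] at h
    rw [← kron_one]
    simpa [kron] using h
  refine (Finset.sum_le_sum fun b _ => h1 b).trans ?_
  rw [Finset.sum_sub_distrib, ← Fintype.prod_sum
    (fun j k => (1 : Matrix (Fin (n j)) (Fin (n j)) ℝ) (a j) k + |G j (a j) k|),
    ← Fintype.prod_sum (fun j k => (1 : Matrix (Fin (n j)) (Fin (n j)) ℝ) (a j) k)]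
  have h3 : ∀ j, ∑ k, (1 : Matrix (Fin (n j)) (Fin (n j)) ℝ) (a j) k = 1 := fun j => by
    simp [Matrix.one_apply]
  simp only [Finset.sum_add_distrib, h3, Finset.prod_const_one]
  gcongr with j _
  exact hG j

lemma schurBound_kron_one_add_sub_one {G : (j : Fin v) → Matrix (Fin (n j)) (Fin (n j)) ℝ}
    {g : Fin v → ℝ} (hG : ∀ j, SchurBound (G j) (g j)) :
    SchurBound (kron (fun j => 1 + G j) - 1) (∏ j, (1 + g j) - 1) where
  nonneg := by
    have : ∏ j : Fin v, (1 : ℝ) ≤ ∏ j, (1 + g j) :=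
      Finset.prod_le_prod (fun _ _ => zero_le_one) fun j _ => by linarith [(hG j).nonneg]
    simpa using this
  row a := sum_abs_kron_one_add_sub_one_le a fun j => (hG j).row (a j)
  col a := by
    have h := sum_abs_kron_one_add_sub_one_le (G := fun j => (G j).transpose) a
      fun j => (hG j).col (a j)
    convert h using 3 with b
    simp [kron, Matrix.one_apply, eq_comm]

lemma prod_one_add_sub_one_le {κ : Type*} (s : Finset κ) {g : κ → ℝ} (hg : ∀ j, 0 ≤ g j)
    (h1 : ∑ j ∈ s, g j ≤ 1) : ∏ j ∈ s, (1 + g j) - 1 ≤ 2 * ∑ j ∈ s, g j := by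
  have h2 := Real.prod_one_add_le_exp_sum s (f := g) hg
  have h0 : 0 ≤ ∑ j ∈ s, g j := Finset.sum_nonneg fun j _ => hg j
  have h3 := Real.abs_exp_sub_one_le (x := ∑ j ∈ s, g j) (by rwa [abs_of_nonneg h0])
  rw [abs_of_nonneg h0] at h3
  linarith [le_abs_self (Real.exp (∑ j ∈ s, g j) - 1)]

/-- The entries of the inverse of a symmetric matrix are at most `1 / c` if the eigenvalues are at
least `c`. -/
lemma abs_inv_apply_le {m : ℕ} {S : Matrix (Fin m) (Fin m) ℝ} (hS : S.IsHermitian) {c : ℝ}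
    (hc : 0 < c) (hlam : ∀ k, c ≤ hS.eigenvalues k) :
    IsUnit S.det ∧ ∀ a b, |S⁻¹ a b| ≤ 1 / c := by
  -- expanding in an eigenbasis shows that `S` expands Euclidean lengths at least by the factor `c`
  have key : ∀ x : Fin m → ℝ, c ^ 2 * ∑ a, x a ^ 2 ≤ ∑ a, (S.mulVec x a) ^ 2 := by
    intro x
    have hpar : ∀ z : Fin m → ℝ, ∑ k, (hS.eigenvectorBasis k ⬝ᵥ z) ^ 2 = ∑ a, z a ^ 2 := by
      intro z
      have h := hS.eigenvectorBasis.sum_sq_norm_inner_right (WithLp.toLp 2 z)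
      rw [EuclideanSpace.norm_sq_eq] at h
      simpa [PiLp.inner_apply, dotProduct, mul_comm] using! h
    rw [← hpar x, ← hpar (S.mulVec x), Finset.mul_sum]
    refine Finset.sum_le_sum fun k _ => ?_
    have hk : hS.eigenvectorBasis k ⬝ᵥ S.mulVec x =
        hS.eigenvalues k * (hS.eigenvectorBasis k ⬝ᵥ x) := by
      rw [Matrix.dotProduct_mulVec, ← Matrix.mulVec_transpose]
      have hT : S.transpose = S := by simpa [Matrix.IsHermitian] using hS
      rw [hT, hS.mulVec_eigenvectorBasis, smul_dotProduct, smul_eq_mul]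
    rw [hk, mul_pow]
    exact mul_le_mul_of_nonneg_right (pow_le_pow_left₀ hc.le (hlam k) 2) (sq_nonneg _)
  have hu : IsUnit S.det := by
    rw [isUnit_iff_ne_zero]
    intro h0
    obtain ⟨x, hx0, hx⟩ := Matrix.exists_mulVec_eq_zero_iff.mpr h0
    obtain ⟨a, ha⟩ := Function.ne_iff.mp hx0
    have h1 := key x
    have h2 : 0 < ∑ a, x a ^ 2 := Finset.sum_pos' (fun _ _ => sq_nonneg _)
      ⟨a, Finset.mem_univ a, by have : x a ≠ 0 := ha; positivity⟩
    simp only [hx, Pi.zero_apply, ne_eq, OfNat.ofNat_ne_zero, not_false_eq_true, zero_pow,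
      Finset.sum_const_zero] at h1
    have : 0 < c ^ 2 * ∑ a, x a ^ 2 := by positivity
    linarith
  refine ⟨hu, fun a b => ?_⟩
  have h1 := key (S⁻¹.mulVec (Pi.single b 1))
  rw [Matrix.mulVec_mulVec, Matrix.mul_nonsing_inv _ hu, Matrix.one_mulVec] at h1
  have h2 : ∑ i, (Pi.single b (1 : ℝ) : Fin m → ℝ) i ^ 2 = 1 := by
    simp [Pi.single_apply]
  have h3 : (S⁻¹ a b) ^ 2 ≤ ∑ i, (S⁻¹.mulVec (Pi.single b 1) i) ^ 2 := by
    simp only [Matrix.mulVec_single_one, Matrix.col_apply]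
    exact Finset.single_le_sum (f := fun i => S⁻¹ i b ^ 2) (fun _ _ => sq_nonneg _)
      (Finset.mem_univ a)
  rw [h2] at h1
  refine abs_le_of_sq_le_sq ?_ (by positivity)
  rw [div_pow, one_pow, le_div_iff₀ (by positivity), mul_comm]
  exact (mul_le_mul_of_nonneg_left h3 (sq_nonneg c)).trans h1

end Kron

/-! ### Fourth moments of Gaussian vectors -/

section Gaussian

/-- The fourth derivative at `0` of the moment generating function `exp (v t² / 2)` is `3 v²`. -/
lemma integral_pow_four_gaussianReal (v : ℝ≥0) :
    ∫ x, x ^ 4 ∂(gaussianReal 0 v) = 3 * (v : ℝ) ^ 2 := by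
  have h := iteratedDeriv_mgf_zero (X := id) (μ := gaussianReal 0 v)
    (by rw [integrableExpSet_id_gaussianReal]; simp) 4
  have hm : mgf id (gaussianReal 0 v) = fun t => Real.exp (v * t ^ 2 / 2) := by
    rw [mgf_id_gaussianReal]; simp
  rw [hm] at h
  have he : ∀ t : ℝ, HasDerivAt (fun t : ℝ => Real.exp (v * t ^ 2 / 2))
      (v * t * Real.exp (v * t ^ 2 / 2)) t := fun t => by
    have h1 : HasDerivAt (fun t : ℝ => (v : ℝ) * t ^ 2 / 2) (v * t) t := by
      have := ((hasDerivAt_pow 2 t).const_mul (v : ℝ)).div_const 2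
      exact this.congr_deriv (by push_cast; ring)
    simpa [mul_comm] using h1.exp
  have hp : ∀ (p : ℝ → ℝ) (p' : ℝ → ℝ), (∀ t, HasDerivAt p (p' t) t) →
      deriv (fun t => p t * Real.exp (v * t ^ 2 / 2)) =
        fun t => (p' t + p t * (v * t)) * Real.exp (v * t ^ 2 / 2) := fun p p' hp => by
    funext t
    rw [((hp t).fun_mul (he t)).deriv]; ring
  have d1 : deriv (fun t : ℝ => Real.exp (v * t ^ 2 / 2)) =
      fun t => (v * t) * Real.exp (v * t ^ 2 / 2) := funext fun t => (he t).deriv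
  have d2 := hp (fun t => v * t) (fun t => v) fun t => by
    simpa using (hasDerivAt_id t).const_mul (v : ℝ)
  have d3 := hp (fun t => v + v * t * (v * t)) (fun t => 2 * v ^ 2 * t) fun t => by
    have h1 := (hasDerivAt_id t).const_mul (v : ℝ)
    have := (h1.fun_mul h1).const_add (v : ℝ)
    exact this.congr_deriv (by simp only [id]; ring)
  have d4 := hp (fun t => 2 * v ^ 2 * t + (v + v * t * (v * t)) * (v * t))
    (fun t => 3 * v ^ 2 + 3 * v ^ 3 * t ^ 2) fun t => by
    have h1 := (hasDerivAt_id t).const_mul (v : ℝ)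
    have := ((hasDerivAt_id t).const_mul (2 * (v : ℝ) ^ 2)).fun_add
      (((h1.fun_mul h1).const_add (v : ℝ)).fun_mul h1)
    exact this.congr_deriv (by simp only [id]; ring)
  rw [iteratedDeriv_succ, iteratedDeriv_succ, iteratedDeriv_succ, iteratedDeriv_one, d1, d2, d3,
    d4] at h
  simpa using h.symm

lemma memLp_two_mul_of_memLp_four {Ω : Type*} [MeasurableSpace Ω] {P : Measure Ω} {f g : Ω → ℝ}
    (hf : MemLp f 4 P) (hg : MemLp g 4 P) : MemLp (fun ω => f ω * g ω) 2 P := by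
  have : ENNReal.HolderTriple 4 4 2 := by
    refine ⟨?_⟩
    rw [← two_mul, show (4 : ENNReal) = 2 * 2 by norm_num,
      ENNReal.mul_inv (Or.inl two_ne_zero) (Or.inl ENNReal.ofNat_ne_top), ← mul_assoc,
      ENNReal.mul_inv_cancel two_ne_zero ENNReal.ofNat_ne_top, one_mul]
  exact hg.mul' hf

variable {ι : Type*} [Fintype ι] [DecidableEq ι] {V : Matrix ι ι ℝ} (m : EuclideanSpace ℝ ι)

lemma memLp_eval_sub_multivariateGaussian (a : ι) {p : ENNReal} (hp : p ≠ ⊤) :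
    MemLp (fun z => z a - m a) p (multivariateGaussian m V) := by
  have h := IsGaussian.memLp_dual (multivariateGaussian m V) (EuclideanSpace.proj a) p hp
  exact h.sub (memLp_const _)

lemma integral_eval_sub_mul_multivariateGaussian (hV : V.PosSemidef) (a b : ι) :
    ∫ z, (z a - m a) * (z b - m b) ∂(multivariateGaussian m V) = V a b := by
  have hm : ∀ a, ∫ z, z a ∂(multivariateGaussian m V) = m a := fun a => by
    have := IsGaussian.integral_dual (μ := multivariateGaussian m V) (EuclideanSpace.proj a)
    simpa using this
  rw [← covariance_eval_multivariateGaussian (μ := m) hV a b, covariance, hm, hm]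

lemma integrable_eval_sub_mul_multivariateGaussian (a b : ι) :
    Integrable (fun z => (z a - m a) * (z b - m b)) (multivariateGaussian m V) :=
  (memLp_eval_sub_multivariateGaussian m (p := 2) a ENNReal.ofNat_ne_top).integrable_mul
    (memLp_eval_sub_multivariateGaussian m (p := 2) b ENNReal.ofNat_ne_top)

/-- Fourth moments of linear forms; polarization then gives all mixed fourth moments. -/
lemma integral_pow_four_sum_multivariateGaussian (hV : V.PosSemidef) (u : ι → ℝ) :
    ∫ z, (∑ a, u a * (z a - m a)) ^ 4 ∂(multivariateGaussian m V) =
      3 * (∑ a, ∑ b, u a * u b * V a b) ^ 2 := by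
  set L : StrongDual ℝ (EuclideanSpace ℝ ι) := ∑ a, u a • EuclideanSpace.proj a with hL
  have hLz : ∀ z, L z = ∑ a, u a * z a := fun z => by simp [hL]
  have hc : ∀ z, ∑ a, u a * (z a - m a) = L z - L m := fun z => by
    simp only [hLz, mul_sub, Finset.sum_sub_distrib]
  have hmean : ∫ z, L z ∂(multivariateGaussian m V) = L m := by
    rw [IsGaussian.integral_dual, integral_id_multivariateGaussian]
  have hvar : Var[L; multivariateGaussian m V] = ∑ a, ∑ b, u a * u b * V a b := by
    rw [variance_eq_integral L.continuous.aemeasurable, hmean]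
    have h1 : ∀ z : EuclideanSpace ℝ ι, (L z - L m) ^ 2 =
        ∑ a, ∑ b, u a * u b * ((z a - m a) * (z b - m b)) := fun z => by
      rw [← hc, sq, Finset.sum_mul_sum]
      exact Finset.sum_congr rfl fun a _ => Finset.sum_congr rfl fun b _ => by ring
    simp only [h1]
    rw [integral_finsetSum _ fun a _ => integrable_finsetSum _ fun b _ =>
      (integrable_eval_sub_mul_multivariateGaussian m a b).const_mul _]
    refine Finset.sum_congr rfl fun a _ => ?_
    rw [integral_finsetSum _ fun b _ =>
      (integrable_eval_sub_mul_multivariateGaussian m a b).const_mul _]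
    refine Finset.sum_congr rfl fun b _ => ?_
    rw [integral_const_mul, integral_eval_sub_mul_multivariateGaussian m hV]
  simp only [hc]
  have hmap := IsGaussian.map_eq_gaussianReal (μ := multivariateGaussian m V) L
  rw [hmean] at hmap
  have h2 : ∫ z, (L z - L m) ^ 4 ∂(multivariateGaussian m V) =
      ∫ x, (x - L m) ^ 4 ∂((multivariateGaussian m V).map L) := by
    rw [integral_map L.continuous.aemeasurable (by fun_prop)]
  have h3 := gaussianReal_map_sub_const (μ := L m) (v := Var[L; multivariateGaussian m V].toNNReal)
    (L m)
  rw [sub_self] at h3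
  rw [h2, hmap]
  have h4 : ∫ x, (x - L m) ^ 4 ∂(gaussianReal (L m) Var[L; multivariateGaussian m V].toNNReal) =
      ∫ x, x ^ 4 ∂(gaussianReal 0 Var[L; multivariateGaussian m V].toNNReal) := by
    rw [← h3, integral_map (by fun_prop) (by fun_prop)]
  rw [h4, integral_pow_four_gaussianReal, Real.coe_toNNReal _ (variance_nonneg _ _), hvar]

lemma integrable_pow_four_sum_multivariateGaussian (u : ι → ℝ) :
    Integrable (fun z => (∑ a, u a * (z a - m a)) ^ 4) (multivariateGaussian m V) := by
  have h : MemLp (fun z => ∑ a, u a * (z a - m a)) 4 (multivariateGaussian m V) :=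
    memLp_finsetSum _ fun a _ =>
      (memLp_eval_sub_multivariateGaussian m a ENNReal.ofNat_ne_top).const_mul (u a)
  have h2 := h.integrable_norm_pow (p := 4) (by norm_num)
  refine h2.congr (ae_of_all _ fun z => ?_)
  simp only [Real.norm_eq_abs]
  exact (even_two_mul 2).pow_abs _

/-- Isserlis' formula for fourth moments. -/
lemma integral_four_mul_multivariateGaussian (hV : V.PosSemidef) (a b c d : ι) :
    ∫ z, (z a - m a) * (z b - m b) * ((z c - m c) * (z d - m d)) ∂(multivariateGaussian m V) =
      V a b * V c d + V a c * V b d + V a d * V b c := by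
  have hsymm : ∀ a b, V a b = V b a := fun a b => by
    simpa using (hV.isHermitian.apply b a)
  let u : Fin 2 × Fin 2 × Fin 2 → ι → ℝ := fun e =>
    Pi.single a 1 + (-1) ^ (e.1 : ℕ) • Pi.single b 1 + (-1) ^ (e.2.1 : ℕ) • Pi.single c 1 +
      (-1) ^ (e.2.2 : ℕ) • Pi.single d 1
  have hu : ∀ e (x : ι → ℝ), ∑ k, u e k * x k =
      x a + (-1) ^ (e.1 : ℕ) * x b + (-1) ^ (e.2.1 : ℕ) * x c + (-1) ^ (e.2.2 : ℕ) * x d := by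
    intro e x
    simp [u, add_mul, Finset.sum_add_distrib, Pi.single_apply]
  have hq : ∀ e, ∑ k, ∑ l, u e k * u e l * V k l = ∑ k, u e k * ∑ l, u e l * V k l := fun e => by
    simp only [Finset.mul_sum, mul_assoc]
  -- polarization identity: the signed sum of the eight fourth powers is `192` times the product
  have hpol : ∀ z : EuclideanSpace ℝ ι,
      (z a - m a) * (z b - m b) * ((z c - m c) * (z d - m d)) =
      ∑ e : Fin 2 × Fin 2 × Fin 2, (1 / 192 * (-1) ^ (e.1 + e.2.1 + e.2.2 : ℕ)) *
        (∑ k, u e k * (z k - m k)) ^ 4 := by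
    intro z
    simp only [hu _ fun k => z k - m k]
    simp only [Fintype.sum_prod_type, Fin.sum_univ_two, Fin.val_zero, Fin.val_one]
    ring
  simp only [hpol]
  rw [integral_finsetSum _ fun e _ =>
    (integrable_pow_four_sum_multivariateGaussian m _).const_mul _]
  simp only [integral_const_mul, integral_pow_four_sum_multivariateGaussian m hV, hq]
  simp only [hu]
  simp only [Fintype.sum_prod_type, Fin.sum_univ_two, Fin.val_zero, Fin.val_one]
  rw [hsymm b a, hsymm c a, hsymm d a, hsymm c b, hsymm d b, hsymm d c]
  ring

lemma covariance_mul_multivariateGaussian (hV : V.PosSemidef) (a b c d : ι) :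
    cov[fun z => (z a - m a) * (z b - m b), fun z => (z c - m c) * (z d - m d);
      multivariateGaussian m V] = V a c * V b d + V a d * V b c := by
  have hL : ∀ a b, MemLp (fun z => (z a - m a) * (z b - m b)) 2 (multivariateGaussian m V) :=
    fun a b => memLp_two_mul_of_memLp_four
      (memLp_eval_sub_multivariateGaussian m a ENNReal.ofNat_ne_top)
      (memLp_eval_sub_multivariateGaussian m b ENNReal.ofNat_ne_top)
  rw [covariance_eq_sub (hL a b) (hL c d), integral_eval_sub_mul_multivariateGaussian m hV,
    integral_eval_sub_mul_multivariateGaussian m hV]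
  simp only [Pi.mul_apply]
  rw [integral_four_mul_multivariateGaussian m hV]
  ring

end Gaussian

/-! ### Averages of independent variables -/

section Averages

variable {Ω : Type*} [MeasurableSpace Ω] {P : Measure Ω}

lemma integral_abs_sub_le_sqrt_variance [IsProbabilityMeasure P] {X : Ω → ℝ}
    (hX : MemLp X 2 P) :
    ∫ ω, |X ω - ∫ ω', X ω' ∂P| ∂P ≤ √(Var[X; P]) := by
  set m := ∫ ω', X ω' ∂P
  have hY : MemLp (fun ω => X ω - m) 2 P := hX.sub (memLp_const m)
  have h := variance_nonneg (|fun ω => X ω - m|) P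
  rw [variance_eq_sub hY.abs] at h
  refine Real.le_sqrt_of_sq_le ?_
  rw [variance_eq_integral hX.aemeasurable]
  simpa using h

lemma variance_average {T : ℕ} {Z : Fin T → Ω → ℝ} (hZ : ∀ t, MemLp (Z t) 2 P)
    (hind : Pairwise fun s t => Z s ⟂ᵢ[P] Z t) :
    Var[fun ω => (T : ℝ)⁻¹ * ∑ t, Z t ω; P] = (T : ℝ)⁻¹ ^ 2 * ∑ t, Var[Z t; P] := by
  rw [variance_const_mul]
  have h := IndepFun.variance_sum (s := Finset.univ) (fun t _ => hZ t)
    (fun s _ t _ hst => hind hst)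
  rw [← h]
  congr 2
  funext ω
  simp

lemma memLp_average {T : ℕ} {Z : Fin T → Ω → ℝ} (hZ : ∀ t, MemLp (Z t) 2 P) :
    MemLp (fun ω => (T : ℝ)⁻¹ * ∑ t, Z t ω) 2 P :=
  (memLp_finsetSum _ fun t _ => hZ t).const_mul _

lemma integral_average [IsProbabilityMeasure P] {T : ℕ} (hT : 0 < T) {Z : Fin T → Ω → ℝ}
    (hZ : ∀ t, MemLp (Z t) 2 P)
    {m : ℝ} (hm : ∀ t, ∫ ω, Z t ω ∂P = m) : ∫ ω, (T : ℝ)⁻¹ * ∑ t, Z t ω ∂P = m := by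
  rw [integral_const_mul, integral_finsetSum _ fun t _ => (hZ t).integrable one_le_two]
  have : (T : ℝ) ≠ 0 := by positivity
  simp only [hm, Finset.sum_const, Finset.card_univ, Fintype.card_fin, nsmul_eq_mul]
  field_simp

lemma integral_abs_average_sub_le [IsProbabilityMeasure P] {T : ℕ} (hT : 0 < T)
    {Z : Fin T → Ω → ℝ} (hZ : ∀ t, MemLp (Z t) 2 P)
    (hind : Pairwise fun s t => Z s ⟂ᵢ[P] Z t) {m B : ℝ}
    (hm : ∀ t, ∫ ω, Z t ω ∂P = m) (hB : ∀ t, Var[Z t; P] ≤ B) :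
    ∫ ω, |(T : ℝ)⁻¹ * ∑ t, Z t ω - m| ∂P ≤ √(B / T) := by
  have h := integral_abs_sub_le_sqrt_variance (memLp_average hZ)
  rw [integral_average hT hZ hm] at h
  refine h.trans (Real.sqrt_le_sqrt ?_)
  have hT' : (0 : ℝ) < T := by positivity
  rw [variance_average hZ hind]
  calc (T : ℝ)⁻¹ ^ 2 * ∑ t, Var[Z t; P] ≤ (T : ℝ)⁻¹ ^ 2 * ∑ _t : Fin T, B := by
        gcongr with t _; exact hB t
    _ = B / T := by simp; field_simp

lemma memLp_four_of_integrable {f : Ω → ℝ} (hf : AEStronglyMeasurable f P)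
    (h : Integrable (fun ω => |f ω| ^ 4) P) : MemLp f 4 P := by
  rw [← integrable_norm_rpow_iff hf (by norm_num) ENNReal.ofNat_ne_top]
  rw [show (4 : ENNReal).toReal = ((4 : ℕ) : ℝ) by norm_num]
  simpa only [Real.rpow_natCast, Real.norm_eq_abs] using h

end Averages

/-! ### Variance of quadratic forms under the kurtosis condition -/

section Kurtosis

lemma sum_sum_sq_le_frobNorm_sq {I : Type*} [Fintype I] (V : Matrix I I ℝ) {s : Finset I}
    {g h : I → I} (hg : Set.InjOn g s) (hh : Set.InjOn h s) :
    ∑ k ∈ s, ∑ l ∈ s, V (g k) (h l) ^ 2 ≤ frobNorm V ^ 2 := by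
  classical
  rw [frobNorm_sq, ← Finset.sum_image (f := fun k => ∑ l ∈ s, V k (h l) ^ 2) hg]
  refine (Finset.sum_le_sum fun k _ => ?_).trans <| Finset.sum_le_sum_of_subset_of_nonneg
    (Finset.subset_univ _) fun k _ _ => Finset.sum_nonneg fun l _ => sq_nonneg (V k l)
  rw [← Finset.sum_image (f := fun l => V k l ^ 2) hh]
  exact Finset.sum_le_sum_of_subset_of_nonneg (Finset.subset_univ _) fun l _ _ => sq_nonneg _

variable {Ω : Type*} [MeasurableSpace Ω] {P : Measure Ω} [IsProbabilityMeasure P]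
  {I : Type*} [Fintype I] [DecidableEq I]

/-- A quadratic form whose coefficient matrix is a partial permutation matrix has, by domination
with the Gaussian case, a variance of the order of the squared Frobenius norm of the covariance. -/
lemma variance_sum_mul_le {x : Ω → I → ℝ} {μ : I → ℝ} {V : Matrix I I ℝ} {C : ℝ} (hC : 0 ≤ C)
    (hV : V.PosSemidef) (hx : ∀ k, MemLp (fun ω => x ω k) 4 P)
    (hkurt : KurtosisDominated P x μ V C) {s : Finset I} {f : I → I} (hf : Set.InjOn f s) :
    Var[fun ω => ∑ k ∈ s, (x ω k - μ k) * (x ω (f k) - μ (f k)); P] ≤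
      2 * C * frobNorm V ^ 2 := by
  have hL : ∀ a b, MemLp (fun ω => (x ω a - μ a) * (x ω b - μ b)) 2 P := fun a b =>
    memLp_two_mul_of_memLp_four ((hx a).sub (memLp_const _)) ((hx b).sub (memLp_const _))
  rw [variance_fun_sum' fun k _ => hL k (f k)]
  have hid : Set.InjOn (id : I → I) s := Set.injOn_id _
  have e1 := sum_sum_sq_le_frobNorm_sq V hid hid
  have e2 := sum_sum_sq_le_frobNorm_sq V hf hf
  have e3 := sum_sum_sq_le_frobNorm_sq V hid hf
  have e4 := sum_sum_sq_le_frobNorm_sq V hf hid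
  calc ∑ k ∈ s, ∑ l ∈ s, cov[fun ω => (x ω k - μ k) * (x ω (f k) - μ (f k)),
        fun ω => (x ω l - μ l) * (x ω (f l) - μ (f l)); P]
      ≤ ∑ k ∈ s, ∑ l ∈ s, C / 2 * (V (id k) (id l) ^ 2 + V (f k) (f l) ^ 2 +
          V (id k) (f l) ^ 2 + V (f k) (id l) ^ 2) := by
        refine Finset.sum_le_sum fun k _ => Finset.sum_le_sum fun l _ => ?_
        refine (hkurt k (f k) l (f l)).trans ?_
        have h := covariance_mul_multivariateGaussian (WithLp.toLp 2 μ) hV k (f k) l (f l)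
        simp only at h
        rw [h, div_mul_eq_mul_div, mul_div_assoc]
        refine mul_le_mul_of_nonneg_left ?_ hC
        simp only [id]
        nlinarith [sq_nonneg (V k l - V (f k) (f l)), sq_nonneg (V k (f l) - V (f k) l)]
    _ ≤ 2 * C * frobNorm V ^ 2 := by
        simp only [← Finset.mul_sum, Finset.sum_add_distrib]
        nlinarith

end Kurtosis

/-! ### Partial traces of the sample covariance matrix -/

section PartialTrace

variable {v : ℕ} {n : Fin v → ℕ}

lemma partialTrace_eq_sum_filter (h : Fin v) (M : Matrix (MultiIdx n) (MultiIdx n) ℝ)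
    (a b : Fin (n h)) : partialTrace h M a b =
      ∑ k ∈ Finset.univ.filter (fun k : MultiIdx n => k h = a), M k (Function.update k h b) := by
  rw [Finset.sum_filter]; rfl

lemma partialTrace_sub (h : Fin v) (M M' : Matrix (MultiIdx n) (MultiIdx n) ℝ) :
    partialTrace h (M - M') = partialTrace h M - partialTrace h M' := by
  ext a b
  simp [partialTrace_eq_sum_filter]

lemma injOn_update (h : Fin v) (a b : Fin (n h)) :
    Set.InjOn (fun k : MultiIdx n => Function.update k h b)
      (Finset.univ.filter fun k : MultiIdx n => k h = a) := by
  intro k hk l hl hkl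
  simp only [Finset.coe_filter, Finset.mem_univ, true_and, Set.mem_ofPred_eq] at hk hl
  funext j
  by_cases hj : j = h
  · subst hj; rw [hk, hl]
  · have := congrFun hkl j
    simpa [Function.update_of_ne hj] using this

lemma trace_partialTrace (h : Fin v) (M : Matrix (MultiIdx n) (MultiIdx n) ℝ) :
    (partialTrace h M).trace = M.trace := by
  simp only [Matrix.trace, Matrix.diag_apply, partialTrace, Matrix.of_apply]
  rw [Finset.sum_comm]
  refine Finset.sum_congr rfl fun k _ => ?_
  rw [Finset.sum_ite_eq]
  simp

lemma sampleCov_apply {I : Type*} {T : ℕ} (hT : 0 < T) (y : Fin T → I → ℝ) (μ : I → ℝ) (k l : I) :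
    sampleCov y k l = (T : ℝ)⁻¹ * ∑ t, (y t k - μ k) * (y t l - μ l) -
      (sampleMean y k - μ k) * (sampleMean y l - μ l) := by
  have hT' : (T : ℝ) ≠ 0 := by positivity
  have hm : ∀ k, ∑ t, y t k = T * sampleMean y k := fun k => by
    simp [sampleMean]; field_simp
  simp only [sampleCov, Matrix.smul_apply, Matrix.sum_apply, Matrix.vecMulVec_apply, Pi.sub_apply,
    smul_eq_mul]
  have h1 : ∀ p q : ℝ, ∑ t, (y t k - p) * (y t l - q) =
      ∑ t, y t k * y t l - q * ∑ t, y t k - p * ∑ t, y t l + T * (p * q) := fun p q => by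
    rw [Finset.mul_sum, Finset.mul_sum, ← Finset.sum_sub_distrib, ← Finset.sum_sub_distrib]
    have : (T : ℝ) * (p * q) = ∑ _t : Fin T, p * q := by simp
    rw [this, ← Finset.sum_add_distrib]
    exact Finset.sum_congr rfl fun t _ => by ring
  rw [h1, h1, hm, hm]
  field_simp
  ring

/-- The error of an entry of a partial trace of the sample covariance matrix consists of the error of
an average of quadratic forms in the variables centered at `μ`, and of the effect of centering at
the sample mean instead. -/
lemma abs_partialTrace_sampleCov_sub_le {T : ℕ} (hT : 0 < T) (y : Fin T → MultiIdx n → ℝ)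
    (μ : MultiIdx n → ℝ) (V : Matrix (MultiIdx n) (MultiIdx n) ℝ) (h : Fin v) (a b : Fin (n h)) :
    |partialTrace h (sampleCov y - V) a b| ≤
      |(T : ℝ)⁻¹ * ∑ t, ∑ k ∈ Finset.univ.filter (fun k : MultiIdx n => k h = a),
          (y t k - μ k) * (y t (Function.update k h b) - μ (Function.update k h b)) -
        partialTrace h V a b| + ∑ k, (sampleMean y k - μ k) ^ 2 := by
  set s := Finset.univ.filter (fun k : MultiIdx n => k h = a) with hs
  set w : MultiIdx n → ℝ := fun k => sampleMean y k - μ k with hw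
  have h1 : partialTrace h (sampleCov y - V) a b =
      ((T : ℝ)⁻¹ * ∑ t, ∑ k ∈ s, (y t k - μ k) *
        (y t (Function.update k h b) - μ (Function.update k h b)) - partialTrace h V a b) -
      ∑ k ∈ s, w k * w (Function.update k h b) := by
    rw [partialTrace_sub, Matrix.sub_apply, partialTrace_eq_sum_filter h (sampleCov y),
      Finset.sum_comm, Finset.mul_sum]
    simp only [sampleCov_apply hT y μ, Finset.sum_sub_distrib, ← hs, hw]
    ring
  rw [h1]
  refine (abs_sub _ _).trans (add_le_add le_rfl ?_)
  have h2 : ∑ k ∈ s, w k ^ 2 ≤ ∑ k, w k ^ 2 :=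
    Finset.sum_le_sum_of_subset_of_nonneg (Finset.subset_univ _) fun _ _ _ => sq_nonneg _
  have h3 : ∑ k ∈ s, w (Function.update k h b) ^ 2 ≤ ∑ k, w k ^ 2 := by
    rw [← Finset.sum_image (f := fun k => w k ^ 2) (injOn_update h a b)]
    exact Finset.sum_le_sum_of_subset_of_nonneg (Finset.subset_univ _) fun _ _ _ => sq_nonneg _
  calc |∑ k ∈ s, w k * w (Function.update k h b)|
      ≤ ∑ k ∈ s, (w k ^ 2 + w (Function.update k h b) ^ 2) / 2 := by
        refine (Finset.abs_sum_le_sum_abs _ _).trans (Finset.sum_le_sum fun k _ => ?_)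
        rw [abs_mul, ← sq_abs (w k), ← sq_abs (w (Function.update k h b))]
        nlinarith [sq_nonneg (|w k| - |w (Function.update k h b)|)]
    _ ≤ ∑ k, w k ^ 2 := by
        rw [← Finset.sum_div, Finset.sum_add_distrib]; linarith

variable {Ω : Type*} [MeasurableSpace Ω] {P : Measure Ω} [IsProbabilityMeasure P]

/-- The summed entrywise errors of all partial traces of the sample covariance matrix are bounded by
an integrable variable: averaging contributes `√(2 C ‖V‖_F² / T)` per entry to its expectation,
and centering at the sample mean `tr V / T`. -/
lemma exists_integrable_bound_partialTrace {T N : ℕ} (hT : 0 < T) (hn : ∀ j, n j ≤ N)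
    {y : Fin T → Ω → MultiIdx n → ℝ} (hy : ∀ t, Measurable (y t)) {μ : MultiIdx n → ℝ}
    {V : Matrix (MultiIdx n) (MultiIdx n) ℝ} (hV : V.PosSemidef)
    (hmean : ∀ t k, ∫ ω, y t ω k ∂P = μ k)
    (hcov : ∀ t k l, cov[fun ω => y t ω k, fun ω => y t ω l; P] = V k l)
    (hindep : iIndepFun y P) (h4 : ∀ t k, Integrable (fun ω => |y t ω k| ^ 4) P)
    {C : ℝ} (hC : 0 ≤ C) (hkurt : ∀ t, KurtosisDominated P (y t) μ V C) :
    ∃ g : Ω → ℝ, Integrable g P ∧ (∀ ω, 0 ≤ g ω) ∧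
      (∀ ω, ∑ h, l1Norm (partialTrace h (sampleCov (fun t => y t ω) - V)) ≤ g ω) ∧
      ∫ ω, g ω ∂P ≤ v * N ^ 2 * (√(2 * C * frobNorm V ^ 2 / T) + V.trace / T) := by
  have hT' : (0 : ℝ) < T := by positivity
  have hyk : ∀ t k, Measurable fun ω => y t ω k := fun t k => (measurable_pi_apply k).comp (hy t)
  have hL4 : ∀ t k, MemLp (fun ω => y t ω k) 4 P := fun t k =>
    memLp_four_of_integrable (hyk t k).aestronglyMeasurable (h4 t k)
  have hL2 : ∀ t k, MemLp (fun ω => y t ω k) 2 P := fun t k =>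
    (hL4 t k).mono_exponent (by norm_num)
  have hprod : ∀ t k l, MemLp (fun ω => (y t ω k - μ k) * (y t ω l - μ l)) 2 P := fun t k l =>
    memLp_two_mul_of_memLp_four ((hL4 t k).sub (memLp_const _)) ((hL4 t l).sub (memLp_const _))
  have hprodE : ∀ t k l, ∫ ω, (y t ω k - μ k) * (y t ω l - μ l) ∂P = V k l := fun t k l => by
    rw [← hcov t k l, covariance, hmean, hmean]
  -- the averaging part of an entry
  let s : (h : Fin v) → Fin (n h) → Finset (MultiIdx n) := fun h a =>
    Finset.univ.filter fun k : MultiIdx n => k h = a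
  let Z : (h : Fin v) → Fin (n h) → Fin (n h) → Fin T → Ω → ℝ := fun h a b t ω =>
    ∑ k ∈ s h a, (y t ω k - μ k) * (y t ω (Function.update k h b) - μ (Function.update k h b))
  have hZ : ∀ h a b t, MemLp (Z h a b t) 2 P := fun h a b t =>
    memLp_finsetSum _ fun k _ => hprod t k _
  have hZE : ∀ h a b t, ∫ ω, Z h a b t ω ∂P = partialTrace h V a b := fun h a b t => by
    rw [partialTrace_eq_sum_filter,
      integral_finsetSum _ fun k _ => (hprod t k _).integrable one_le_two]
    exact Finset.sum_congr rfl fun k _ => hprodE t k _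
  have hZi : ∀ h a b, Pairwise fun r t => Z h a b r ⟂ᵢ[P] Z h a b t := fun h a b r t hrt => by
    let φ : (MultiIdx n → ℝ) → ℝ := fun x =>
      ∑ k ∈ s h a, (x k - μ k) * (x (Function.update k h b) - μ (Function.update k h b))
    have hφ : Measurable φ := by fun_prop
    exact (hindep.indepFun hrt).comp hφ hφ
  have hZV : ∀ h a b t, Var[Z h a b t; P] ≤ 2 * C * frobNorm V ^ 2 := fun h a b t =>
    variance_sum_mul_le hC hV (hL4 t) (hkurt t) (injOn_update h a b)
  let D : (h : Fin v) → Fin (n h) → Fin (n h) → Ω → ℝ := fun h a b ω =>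
    |(T : ℝ)⁻¹ * ∑ t, Z h a b t ω - partialTrace h V a b|
  have hDi : ∀ h a b, Integrable (D h a b) P := fun h a b =>
    (((memLp_average (hZ h a b)).integrable one_le_two).sub (integrable_const _)).abs
  have hDE : ∀ h a b, ∫ ω, D h a b ω ∂P ≤ √(2 * C * frobNorm V ^ 2 / T) := fun h a b =>
    integral_abs_average_sub_le hT (hZ h a b) (hZi h a b) (hZE h a b) (hZV h a b)
  -- the centering part
  let W : Ω → ℝ := fun ω => ∑ k, (sampleMean (fun t => y t ω) k - μ k) ^ 2
  have hmeanEq : ∀ ω k, sampleMean (fun t => y t ω) k = (T : ℝ)⁻¹ * ∑ t, y t ω k := fun ω k => by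
    simp [sampleMean]
  have hwL : ∀ k, MemLp (fun ω => sampleMean (fun t => y t ω) k) 2 P := fun k => by
    simp only [hmeanEq]
    exact memLp_average fun t => hL2 t k
  have hwi : ∀ k, Integrable (fun ω => (sampleMean (fun t => y t ω) k - μ k) ^ 2) P := fun k =>
    ((hwL k).sub (memLp_const _)).integrable_sq
  have hWi : Integrable W P := integrable_finsetSum _ fun k _ => hwi k
  have hWE : ∫ ω, W ω ∂P = V.trace / T := by
    rw [integral_finsetSum _ fun k _ => hwi k, Matrix.trace, Finset.sum_div]
    refine Finset.sum_congr rfl fun k _ => ?_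
    have h1 : ∫ ω, sampleMean (fun t => y t ω) k ∂P = μ k := by
      simp only [hmeanEq]
      exact integral_average hT (fun t => hL2 t k) fun t => hmean t k
    have h2 := variance_eq_integral (hwL k).aemeasurable
    rw [h1] at h2
    rw [← h2]
    simp only [hmeanEq]
    rw [variance_average (fun t => hL2 t k) fun r t hrt =>
      (hindep.indepFun hrt).comp (measurable_pi_apply k) (measurable_pi_apply k)]
    have h3 : ∀ t, Var[fun ω => y t ω k; P] = V k k := fun t => by
      rw [← covariance_self (hyk t k).aemeasurable, hcov]
    simp only [h3, Finset.sum_const, Finset.card_univ, Fintype.card_fin, nsmul_eq_mul,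
      Matrix.diag_apply]
    field_simp
  have hWnn : ∀ ω, 0 ≤ W ω := fun ω => Finset.sum_nonneg fun _ _ => sq_nonneg _
  have hDW : ∀ h a b, Integrable (fun ω => D h a b ω + W ω) P := fun h a b => (hDi h a b).add hWi
  refine ⟨fun ω => ∑ h, ∑ a, ∑ b, (D h a b ω + W ω), ?_, ?_, ?_, ?_⟩
  · exact integrable_finsetSum _ fun h _ => integrable_finsetSum _ fun a _ =>
      integrable_finsetSum _ fun b _ => hDW h a b
  · exact fun ω => Finset.sum_nonneg fun h _ => Finset.sum_nonneg fun a _ =>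
      Finset.sum_nonneg fun b _ => add_nonneg (abs_nonneg _) (hWnn ω)
  · exact fun ω => Finset.sum_le_sum fun h _ => Finset.sum_le_sum fun a _ =>
      Finset.sum_le_sum fun b _ => abs_partialTrace_sampleCov_sub_le hT _ μ V h a b
  · set q := √(2 * C * frobNorm V ^ 2 / T) + V.trace / T with hq
    have hq0 : 0 ≤ q := add_nonneg (Real.sqrt_nonneg _) <| by
      rw [← hWE]; exact integral_nonneg hWnn
    rw [integral_finsetSum _ fun h _ => integrable_finsetSum _ fun a _ =>
      integrable_finsetSum _ fun b _ => hDW h a b]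
    calc ∑ h, ∫ ω, ∑ a, ∑ b, (D h a b ω + W ω) ∂P ≤ ∑ _h : Fin v, (N : ℝ) ^ 2 * q := by
          refine Finset.sum_le_sum fun h _ => ?_
          rw [integral_finsetSum _ fun a _ => integrable_finsetSum _ fun b _ =>
            hDW h a b]
          calc ∑ a, ∫ ω, ∑ b, (D h a b ω + W ω) ∂P ≤ ∑ _a : Fin (n h), ∑ _b : Fin (n h), q := by
                refine Finset.sum_le_sum fun a _ => ?_
                rw [integral_finsetSum _ fun b _ => hDW h a b]
                refine Finset.sum_le_sum fun b _ => ?_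
                rw [integral_add (hDi h a b) hWi, hWE]
                exact add_le_add (hDE h a b) le_rfl
            _ = (n h : ℝ) ^ 2 * q := by simp; ring
            _ ≤ (N : ℝ) ^ 2 * q := by
                have : (n h : ℝ) ≤ N := by exact_mod_cast hn h
                gcongr
      _ = v * N ^ 2 * q := by simp; ring

end PartialTrace

/-! ### Perturbation of the Kronecker product estimator -/

section Perturbation

variable {v : ℕ} {n : Fin v → ℕ}

lemma partialTrace_kron (h : Fin v) (S : (j : Fin v) → Matrix (Fin (n j)) (Fin (n j)) ℝ) :
    partialTrace h (kron S) = (∏ j ∈ Finset.univ.erase h, (S j).trace) • S h := by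
  ext a b
  let F : (j : Fin v) → Fin (n j) → ℝ :=
    Function.update (fun j x => S j x x) h fun x => if x = a then S h a b else 0
  have h1 : ∀ k : MultiIdx n, (if k h = a then kron S k (Function.update k h b) else 0) =
      ∏ j, F j (k j) := by
    intro k
    have h2 : ∏ j ∈ Finset.univ.erase h, F j (k j) =
        ∏ j ∈ Finset.univ.erase h, S j (k j) (Function.update k h b j) :=
      Finset.prod_congr rfl fun j hj => by
        have hj' := Finset.ne_of_mem_erase hj
        simp [F, Function.update_of_ne hj']
    rw [← Finset.mul_prod_erase _ _ (Finset.mem_univ h), h2]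
    simp only [kron, Matrix.of_apply]
    rw [← Finset.mul_prod_erase _ _ (Finset.mem_univ h)]
    by_cases hk : k h = a
    · simp [F, hk]
    · simp [F, hk]
  have h3 : ∏ j ∈ Finset.univ.erase h, ∑ x, F j x = ∏ j ∈ Finset.univ.erase h, (S j).trace :=
    Finset.prod_congr rfl fun j hj => by
      have hj' := Finset.ne_of_mem_erase hj
      simp [F, Function.update_of_ne hj', Matrix.trace]
  simp only [partialTrace, Matrix.of_apply, h1, Matrix.smul_apply, smul_eq_mul]
  rw [← Fintype.prod_sum, ← Finset.mul_prod_erase _ _ (Finset.mem_univ h), h3, mul_comm]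
  simp [F]

/-- The partial traces of the model determine its factors: with `n = n_1 ⋯ n_v`, the other factors
contribute the product `n / n_h` of their traces. -/
lemma smul_partialTrace_kronModel (h : Fin v) (s2 : ℝ)
    {S : (j : Fin v) → Matrix (Fin (n j)) (Fin (n j)) ℝ} (hS : ∀ j, (S j).trace = (n j : ℝ)) :
    (n h : ℝ) • partialTrace h (kronModel s2 S) = ((totalDim n : ℝ) * s2) • S h := by
  have h1 : partialTrace h (kronModel s2 S) = s2 • partialTrace h (kron S) := by
    ext a b
    simp [partialTrace_eq_sum_filter, kronModel, Finset.mul_sum]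
  rw [h1, partialTrace_kron, smul_smul, smul_smul, totalDim, Nat.cast_prod,
    ← Finset.mul_prod_erase _ _ (Finset.mem_univ h)]
  simp only [hS]
  congr 1
  ring

/-- The factor estimators have a common normalization error `δ` and individual errors `Δ_h`; if
these are small, then the estimator is the true covariance matrix times a small perturbation of the
identity.  In the constant, `N / c` bounds the row and column sums of the inverse factors, `6` is
`3 / 2 * 2 * 2` from `1 + δ ≤ 3 / 2`, `(1 + δ)⁻¹ ≤ 2` and `∏ (1 + g_h) - 1 ≤ 2 ∑ g_h`, and the last
`1` accounts for `δ` itself. -/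
lemma exists_quadFormEst_eq_mul_one_add {N : ℕ} {c s2 : ℝ} (hc : 0 < c) (hs2 : 0 < s2)
    (hv : 0 < v) (hn1 : ∀ j, 1 ≤ n j) (hnN : ∀ j, n j ≤ N)
    {S : (j : Fin v) → Matrix (Fin (n j)) (Fin (n j)) ℝ} (hS : ∀ j, (S j).IsHermitian)
    (hStr : ∀ j, (S j).trace = (n j : ℝ)) (hlam : ∀ j k, c ≤ (hS j).eigenvalues k)
    {T : ℕ} (y : Fin T → MultiIdx n → ℝ) {X : ℝ}
    (hX : N / (totalDim n * s2) *
      ∑ h, l1Norm (partialTrace h (sampleCov y - kronModel s2 S)) ≤ X)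
    (hX1 : (6 * (N / c + 1) + 1) * X ≤ 1 / 2) :
    ∃ R, SchurBound R ((6 * (N / c + 1) + 1) * X) ∧
      quadFormEst y = kronModel s2 S * (1 + R) := by
  set M := sampleCov y with hM
  set d : ℝ := (totalDim n : ℝ) with hd
  have hd0 : 0 < d := by
    rw [hd, totalDim]; exact_mod_cast Finset.prod_pos fun j _ => hn1 j
  have hn0 : ∀ j, (0 : ℝ) < n j := fun j => by exact_mod_cast hn1 j
  have hds : 0 < d * s2 := mul_pos hd0 hs2
  have hNc : 0 ≤ N / c := by positivity
  let Δ : (j : Fin v) → Matrix (Fin (n j)) (Fin (n j)) ℝ := fun j =>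
    ((n j : ℝ) / (d * s2)) • partialTrace j (M - kronModel s2 S)
  let ℓ : Fin v → ℝ := fun j => l1Norm (Δ j)
  have hℓ0 : ∀ j, 0 ≤ ℓ j := fun j => l1Norm_nonneg _
  have hℓX : ∑ j, ℓ j ≤ X := by
    refine le_trans ?_ hX
    rw [Finset.mul_sum]
    refine Finset.sum_le_sum fun j _ => ?_
    have h1 : ℓ j = (n j : ℝ) / (d * s2) * l1Norm (partialTrace j (M - kronModel s2 S)) := by
      simp only [ℓ, Δ, l1Norm, Matrix.smul_apply, smul_eq_mul, abs_mul, Finset.mul_sum]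
      rw [abs_of_nonneg (div_nonneg (hn0 j).le hds.le)]
    rw [h1]
    have h2 : (n j : ℝ) ≤ N := by exact_mod_cast hnN j
    have := l1Norm_nonneg (partialTrace j (M - kronModel s2 S))
    gcongr
  have hX0 : 0 ≤ X := (Finset.sum_nonneg fun j _ => hℓ0 j).trans hℓX
  have hptr : ∀ j, (n j : ℝ) • partialTrace j M = (d * s2) • (S j + Δ j) := fun j => by
    simp only [Δ]
    rw [smul_add, ← smul_partialTrace_kronModel j s2 hStr, smul_smul,
      mul_div_cancel₀ _ hds.ne', partialTrace_sub, ← smul_add, add_sub_cancel]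
  -- the common normalization error
  set δ : ℝ := M.trace / (d * s2) - 1 with hδ
  have htrM : M.trace = d * s2 * (1 + δ) := by rw [hδ]; field_simp; ring
  have hδΔ : ∀ j, (Δ j).trace = n j * δ := fun j => by
    have h1 := congrArg Matrix.trace (hptr j)
    rw [Matrix.trace_smul, Matrix.trace_smul, trace_partialTrace, Matrix.trace_add, hStr, htrM,
      smul_eq_mul, smul_eq_mul] at h1
    have h2 : d * s2 * (n j * (1 + δ)) = d * s2 * (n j + (Δ j).trace) := by rw [← h1]; ring
    have h3 := mul_left_cancel₀ hds.ne' h2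
    linarith
  have hδℓ : ∀ j, |δ| ≤ ℓ j := fun j => by
    have h1 := abs_trace_le_l1Norm (Δ j)
    rw [hδΔ, abs_mul, abs_of_pos (hn0 j)] at h1
    have h2 : (1 : ℝ) ≤ n j := by exact_mod_cast hn1 j
    have h3 : |δ| ≤ n j * |δ| := le_mul_of_one_le_left (abs_nonneg δ) h2
    exact h3.trans h1
  have hδX : |δ| ≤ X := (hδℓ ⟨0, hv⟩).trans <|
    (Finset.single_le_sum (fun j _ => hℓ0 j) (Finset.mem_univ _)).trans hℓX
  have hX2 : X ≤ 1 / 14 := by nlinarith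
  have hδ2 := abs_le.mp (hδX.trans hX2)
  have hδ1 : 0 < 1 + δ := by linarith
  have hinv : |(1 + δ)⁻¹| ≤ 2 := by
    rw [abs_of_pos (inv_pos.mpr hδ1), inv_le_comm₀ hδ1 two_pos]; linarith
  -- relative errors of the factors
  let G : (j : Fin v) → Matrix (Fin (n j)) (Fin (n j)) ℝ := fun j =>
    (1 + δ)⁻¹ • ((S j)⁻¹ * Δ j + (-δ) • (1 : Matrix (Fin (n j)) (Fin (n j)) ℝ))
  have hSinv : ∀ j, SchurBound (S j)⁻¹ (N / c) := fun j => by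
    have h1 := (abs_inv_apply_le (hS j) hc (hlam j)).2
    have h2 : (n j : ℝ) ≤ N := by exact_mod_cast hnN j
    have h3 : (n j : ℝ) * (1 / c) ≤ N / c := by rw [mul_one_div]; gcongr
    refine ⟨hNc, fun a => ?_, fun a => ?_⟩
    · refine (Finset.sum_le_sum fun b _ => h1 a b).trans ?_
      simpa using h3
    · refine (Finset.sum_le_sum fun b _ => h1 b a).trans ?_
      simpa using h3
  have hG : ∀ j, SchurBound (G j) (2 * (N / c + 1) * ℓ j) := fun j => by
    have h1 := (schurBound_l1Norm ((S j)⁻¹ * Δ j)).mono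
      (isSchurIdealNorm_l1Norm.mul_left _ _ _ (hSinv j))
    refine ((h1.add (schurBound_one.smul (-δ))).smul (1 + δ)⁻¹).mono ?_
    have h2 := hδℓ j
    have h3 : 0 ≤ l1Norm (Δ j) := hℓ0 j
    have h4 : |δ| ≤ l1Norm (Δ j) := h2
    calc |(1 + δ)⁻¹| * (l1Norm (Δ j) * (N / c) + |(-δ)| * 1)
        ≤ 2 * (l1Norm (Δ j) * (N / c) + l1Norm (Δ j)) := by
          rw [abs_neg, mul_one]; gcongr
      _ = 2 * (N / c + 1) * ℓ j := by simp only [ℓ]; ring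
  have hSG : ∀ j, S j * (1 + G j) = (1 + δ)⁻¹ • (S j + Δ j) := fun j => by
    have hu := (abs_inv_apply_le (hS j) hc (hlam j)).1
    simp only [G]
    rw [mul_add, mul_one, Matrix.mul_smul, mul_add, ← mul_assoc, Matrix.mul_nonsing_inv _ hu,
      one_mul, Matrix.mul_smul, mul_one]
    ext a b
    simp only [Matrix.add_apply, Matrix.smul_apply, smul_eq_mul]
    field_simp
    ring
  have hfac : ∀ j, factorEst y j = S j * (1 + G j) := fun j => by
    rw [hSG, factorEst, ← hM, trace_partialTrace, htrM]
    have h1 : partialTrace j M = ((n j : ℝ)⁻¹ * (d * s2)) • (S j + Δ j) := by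
      rw [← smul_smul, ← hptr, smul_smul, inv_mul_cancel₀ (hn0 j).ne', one_smul]
    rw [h1, smul_smul]
    congr 1
    have := (hn0 j).ne'
    field_simp
  have hsig : sigmaSqHat y = s2 * (1 + δ) := by
    rw [sigmaSqHat, ← hM, htrM, ← hd]
    field_simp
  refine ⟨(1 + δ) • (kron (fun j => 1 + G j) - 1) + δ • 1, ?_, ?_⟩
  · have hsum : ∑ j, 2 * (N / c + 1) * ℓ j ≤ 2 * (N / c + 1) * X := by
      rw [← Finset.mul_sum]; gcongr
    have h1 : ∏ j, (1 + 2 * (N / c + 1) * ℓ j) - 1 ≤ 2 * (2 * (N / c + 1) * X) := by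
      have := prod_one_add_sub_one_le Finset.univ (g := fun j => 2 * (N / c + 1) * ℓ j)
        (fun j => by have := hℓ0 j; positivity) (by nlinarith)
      linarith
    refine ((((schurBound_kron_one_add_sub_one hG).mono h1).smul (1 + δ)).add
      (schurBound_one.smul δ)).mono ?_
    rw [abs_of_pos hδ1, mul_one]
    have h3 : 0 ≤ (N / c + 1) * X := by positivity
    nlinarith [hδ2.2]
  · have h1 : (1 : Matrix (MultiIdx n) (MultiIdx n) ℝ) +
        ((1 + δ) • (kron (fun j => 1 + G j) - 1) + δ • 1) = (1 + δ) • kron fun j => 1 + G j := by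
      rw [smul_sub, add_smul 1 δ (1 : Matrix (MultiIdx n) (MultiIdx n) ℝ), one_smul]
      abel
    rw [h1, quadFormEst, hsig, kronModel, Matrix.smul_mul, Matrix.mul_smul, kron_mul, smul_smul]
    congr 2
    exact funext hfac

lemma isUnit_kronModel {c s2 : ℝ} (hc : 0 < c) (hs2 : 0 < s2)
    {S : (j : Fin v) → Matrix (Fin (n j)) (Fin (n j)) ℝ} (hS : ∀ j, (S j).IsHermitian)
    (hlam : ∀ j k, c ≤ (hS j).eigenvalues k) : IsUnit (kronModel s2 S) := by
  have h1 : kron S * kron (fun j => (S j)⁻¹) = 1 := by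
    rw [kron_mul, ← kron_one]
    exact congrArg kron (funext fun j =>
      Matrix.mul_nonsing_inv _ (abs_inv_apply_le (hS j) hc (hlam j)).1)
  rw [Matrix.isUnit_iff_isUnit_det]
  refine Matrix.isUnit_det_of_right_inverse (B := s2⁻¹ • kron (fun j => (S j)⁻¹)) ?_
  rw [kronModel, Matrix.smul_mul, Matrix.mul_smul, h1, smul_smul, mul_inv_cancel₀ hs2.ne',
    one_smul]

lemma trace_kronModel (s2 : ℝ) {S : (j : Fin v) → Matrix (Fin (n j)) (Fin (n j)) ℝ}
    (hStr : ∀ j, (S j).trace = (n j : ℝ)) : (kronModel s2 S).trace = totalDim n * s2 := by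
  rw [kronModel, Matrix.trace_smul, trace_kron, totalDim, Nat.cast_prod, smul_eq_mul, mul_comm]
  simp only [hStr]

lemma posSemidef_kronModel {s2 : ℝ} (hs2 : 0 ≤ s2)
    {S : (j : Fin v) → Matrix (Fin (n j)) (Fin (n j)) ℝ} (hS : ∀ j, (S j).PosSemidef) :
    (kronModel s2 S).PosSemidef :=
  (posSemidef_kron hS).smul hs2

end Perturbation

/-! ### Stochastic orders -/

section StochasticOrder

variable {ι : Type*} {l : Filter ι} {Ω : ι → Type*} [∀ i, MeasurableSpace (Ω i)]
  {P : ∀ i, Measure (Ω i)}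

/-- An error of order `a + b` splits into parts proportional to `a` and to `b`. -/
lemma IsBigOp.isBigOpSum {E : ∀ i, Ω i → ℝ} {a b : ι → ℝ} (hE : IsBigOp P l E fun i => a i + b i)
    (ha : ∀ i, 0 ≤ a i) (hb : ∀ i, 0 ≤ b i) (hab : ∀ᶠ i in l, 0 < a i + b i) :
    IsBigOpSum P l E a b := by
  have hsub : ∀ {x e K s : ℝ}, 0 ≤ x → 0 < s → K * x < |e * (x / s)| → K * s < |e| := by
    intro x e K s hx hs h
    by_contra! hle
    rw [abs_mul, abs_of_nonneg (div_nonneg hx hs.le)] at h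
    have h1 : |e| * (x / s) ≤ K * s * (x / s) := by gcongr
    have h2 : K * s * (x / s) = K * x := by field_simp
    linarith
  refine ⟨fun i ω => E i ω * (a i / (a i + b i)), fun i ω => E i ω - E i ω * (a i / (a i + b i)),
    fun i ω => by ring, fun ε hε => ?_, fun ε hε => ?_⟩
  · obtain ⟨K, hK, h⟩ := hE ε hε
    refine ⟨K, hK, ?_⟩
    filter_upwards [h, hab] with i hi hi2
    exact (measure_mono fun ω hω => hsub (ha i) hi2 hω).trans hi
  · obtain ⟨K, hK, h⟩ := hE ε hε
    refine ⟨K, hK, ?_⟩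
    filter_upwards [h, hab] with i hi hi2
    refine (measure_mono fun ω hω => hsub (hb i) hi2 ?_).trans hi
    have h1 : E i ω - E i ω * (a i / (a i + b i)) = E i ω * (b i / (a i + b i)) := by
      field_simp; ring
    have hω' : K * b i < |E i ω - E i ω * (a i / (a i + b i))| := hω
    rwa [h1] at hω'

lemma IsBigOp.isLittleOpOne {E : ∀ i, Ω i → ℝ} {r : ι → ℝ} (hE : IsBigOp P l E r)
    (hr : Tendsto r l (𝓝 0)) : IsLittleOpOne P l E := by
  intro δ hδ
  rw [ENNReal.tendsto_nhds_zero]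
  intro ε hε
  obtain ⟨ε', hε'0, hε'⟩ : ∃ ε' : ℝ, 0 < ε' ∧ ENNReal.ofReal ε' ≤ ε := by
    rcases eq_or_ne ε ⊤ with rfl | h
    · exact ⟨1, one_pos, le_top⟩
    · exact ⟨ε.toReal, ENNReal.toReal_pos hε.ne' h, ENNReal.ofReal_toReal_le⟩
  obtain ⟨K, hK, h⟩ := hE ε' hε'0
  have h2 : ∀ᶠ i in l, r i < δ / K := hr.eventually_lt_const (by positivity)
  filter_upwards [h, h2] with i hi hi2
  refine (measure_mono fun ω hω => ?_).trans (hi.trans hε')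
  have h3 : K * r i < δ := by rw [lt_div_iff₀ hK] at hi2; linarith
  exact h3.trans hω

/-- Markov's inequality for errors which, where a variable `X` of small expectation is small, are
bounded by a multiple of `X`. -/
lemma isBigOp_of_dominated {E : ∀ i, Ω i → ℝ} {r : ι → ℝ} {K₀ K₁ : ℝ} (hK₀ : 0 < K₀) (hK₁ : 0 < K₁)
    (hr : Tendsto r l (𝓝 0)) (hr0 : ∀ᶠ i in l, 0 < r i)
    (hE : ∀ᶠ i in l, ∃ X : Ω i → ℝ, Integrable X (P i) ∧ (∀ ω, 0 ≤ X ω) ∧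
      ∫ ω, X ω ∂(P i) ≤ K₁ * r i ∧ ∀ ω, K₀ * X ω ≤ 1 / 2 → |E i ω| ≤ 2 * (K₀ * X ω)) :
    IsBigOp P l E r := by
  intro ε hε
  refine ⟨2 * K₀ * K₁ / ε, by positivity, ?_⟩
  have h2 : ∀ᶠ i in l, r i < ε / (2 * K₀ * K₁) := hr.eventually_lt_const (by positivity)
  filter_upwards [hE, hr0, h2] with i ⟨X, hXi, hX0, hXE, hX⟩ hri hi2
  have h3 : 2 * K₀ * K₁ / ε * r i < 1 := by
    rw [lt_div_iff₀ (by positivity)] at hi2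
    rw [div_mul_eq_mul_div, div_lt_one hε]
    linarith
  have hx : 0 < K₁ * r i / ε := by positivity
  have hsub : {ω | 2 * K₀ * K₁ / ε * r i < |E i ω|} ⊆ {ω | K₁ * r i / ε ≤ X ω} := by
    intro ω hω
    simp only [Set.mem_ofPred_eq] at hω ⊢
    have e : 2 * K₀ * K₁ / ε * r i = 2 * (K₀ * (K₁ * r i / ε)) := by ring
    rw [e] at hω h3
    by_contra! hlt
    have h4 : K₀ * X ω < K₀ * (K₁ * r i / ε) := by gcongr
    have h5 := hX ω (by linarith)
    linarith
  refine (measure_mono hsub).trans ?_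
  have hmk := mul_meas_ge_le_integral_of_nonneg (ae_of_all _ hX0) hXi (K₁ * r i / ε)
  have hfin : P i {ω | K₁ * r i / ε ≤ X ω} ≠ ⊤ := (hXi.measure_ge_lt_top hx).ne
  rw [← ENNReal.ofReal_toReal hfin]
  refine ENNReal.ofReal_le_ofReal ?_
  have h6 : K₁ * r i / ε * (P i {ω | K₁ * r i / ε ≤ X ω}).toReal ≤ K₁ * r i / ε * ε := by
    refine (hmk.trans hXE).trans (le_of_eq ?_)
    field_simp
  exact le_of_mul_le_mul_left h6 hx

end StochasticOrder

/-! ### Rates -/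

section Rates

lemma relErr_nonneg {ι : Type*} {nrm : Matrix ι ι ℝ → ℝ} (h : ∀ A, 0 ≤ nrm A) (A B : Matrix ι ι ℝ) :
    0 ≤ relErr nrm A B :=
  div_nonneg (h _) (h _)

lemma rateAveraging_nonneg (n T : ℕ) (β : ℝ) : 0 ≤ rateAveraging n T β := Real.sqrt_nonneg _

lemma rateCentering_nonneg (n T : ℕ) : 0 ≤ rateCentering n T := by
  unfold rateCentering; positivity

lemma rateAveraging_le {n T : ℕ} {β : ℝ} (hn : 1 ≤ n) (hβ : β ≤ 2) :
    rateAveraging n T β ≤ √(Real.log n ^ 3 / T) := by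
  refine Real.sqrt_le_sqrt ?_
  have h1 : (1 : ℝ) ≤ n := by exact_mod_cast hn
  have h2 : (1 : ℝ) ≤ (n : ℝ) ^ (2 - β) := Real.one_le_rpow h1 (by linarith)
  have h3 : 0 ≤ Real.log n := Real.log_nonneg h1
  rcases Nat.eq_zero_or_pos T with rfl | hT
  · simp
  · have hT' : (0 : ℝ) < T := by exact_mod_cast hT
    gcongr
    exact le_mul_of_one_le_left hT'.le h2

lemma rateCentering_le {n T : ℕ} (hlog : 1 ≤ Real.log n) :
    rateCentering n T ≤ Real.log n ^ 3 / T := by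
  unfold rateCentering
  gcongr
  norm_num

lemma natCast_mul_log_two_le_log_totalDim {v : ℕ} {n : Fin v → ℕ} (hn : ∀ j, 2 ≤ n j) :
    v * Real.log 2 ≤ Real.log (totalDim n) := by
  have h1 : 2 ^ v ≤ totalDim n := by
    have := Finset.prod_le_prod' (s := Finset.univ) (f := fun _ : Fin v => 2) (g := n)
      fun j _ => hn j
    simpa [totalDim] using this
  rw [← Real.log_pow]
  exact Real.log_le_log (by positivity) (by exact_mod_cast h1)

/-- The expected total error of the factors is of the order of the two rates: the number `v` of
factors is at most `2 log n`, and `1 ≤ log n` allows for the higher powers of `log n` in the rates.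
-/
lemma mul_sqrt_add_le_rates {v n T : ℕ} {β C F s s2 w : ℝ} (hT : 0 < T) (hn : 1 ≤ n)
    (hlog : 1 ≤ Real.log n) (hv : (v : ℝ) ≤ 2 * Real.log n) (hC : 0 ≤ C) (hs : 0 < s)
    (hs2 : s ≤ s2) (hw : 0 ≤ w) (hF : F ^ 2 ≤ w * (n : ℝ) ^ β) :
    v * (√(2 * C * F ^ 2 / T) / (n * s2) + 1 / T) ≤
      2 * (√(2 * C * w) / s + 1) * (rateAveraging n T β + rateCentering n T) := by
  have hn0 : (0 : ℝ) < n := by exact_mod_cast hn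
  have hT0 : (0 : ℝ) < T := by exact_mod_cast hT
  have hs20 : 0 < s2 := hs.trans_le hs2
  have hL : 0 < Real.log n := by linarith
  set A := 1 / ((n : ℝ) ^ (2 - β) * T) with hA
  have hA0 : 0 ≤ A := by positivity
  have h1 : √(2 * C * F ^ 2 / T) / (n * s2) ≤ √(2 * C * w) / s * √A := by
    have h2 : √(2 * C * F ^ 2 / T) ≤ √(2 * C * w) * (n * √A) := by
      have h3 : n * √A = √(n ^ 2 * A) := by
        rw [Real.sqrt_mul (by positivity), Real.sqrt_sq hn0.le]
      rw [h3, ← Real.sqrt_mul (by positivity)]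
      refine Real.sqrt_le_sqrt ?_
      have h4 : (n : ℝ) ^ 2 * A = (n : ℝ) ^ β / T := by
        rw [hA, Real.rpow_sub hn0]
        have : (0 : ℝ) < (n : ℝ) ^ β := by positivity
        simp only [Real.rpow_ofNat]
        field_simp
      rw [h4, ← mul_div_assoc]
      refine div_le_div_of_nonneg_right ?_ hT0.le
      rw [mul_assoc (2 * C)]
      exact mul_le_mul_of_nonneg_left hF (by positivity)
    calc √(2 * C * F ^ 2 / T) / (n * s2) ≤ √(2 * C * w) * (n * √A) / (n * s) := by gcongr
      _ = √(2 * C * w) / s * √A := by field_simp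
  have h5 : Real.log n * √A ≤ rateAveraging n T β := by
    have h6 : rateAveraging n T β = √(Real.log n ^ 3) * √A := by
      rw [rateAveraging, ← Real.sqrt_mul (by positivity), hA, mul_one_div]
    rw [h6]
    refine mul_le_mul_of_nonneg_right (Real.le_sqrt_of_sq_le ?_) (Real.sqrt_nonneg _)
    exact pow_le_pow_right₀ hlog (by norm_num)
  have h7 : Real.log n * (1 / T) ≤ rateCentering n T := by
    rw [rateCentering, mul_one_div]
    gcongr
    nlinarith
  have hκ : 0 ≤ √(2 * C * w) / s := by positivity
  have ha := rateAveraging_nonneg n T β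
  have hb := rateCentering_nonneg n T
  calc v * (√(2 * C * F ^ 2 / T) / (n * s2) + 1 / T)
      ≤ 2 * Real.log n * (√(2 * C * w) / s * √A + 1 / T) := by gcongr
    _ = 2 * (√(2 * C * w) / s * (Real.log n * √A) + Real.log n * (1 / T)) := by ring
    _ ≤ 2 * (√(2 * C * w) / s * rateAveraging n T β + rateCentering n T) := by gcongr
    _ ≤ _ := by nlinarith [mul_nonneg hκ hb]

end Rates

end KroneckerCov

end

open KroneckerCov

/-! ### Relative errors of the estimator -/

theorem mainTheorem1
    {ι : Type*} (l : Filter ι)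
    -- number of factors, factor dimensions, sample size; `N` is an absolute bound
    (v : ι → ℕ) (n : (i : ι) → Fin (v i) → ℕ) (T : ι → ℕ) (N : ℕ)
    (hv : Tendsto v l atTop) (hT : Tendsto T l atTop)
    (hn : ∀ i j, 2 ≤ n i j ∧ n i j ≤ N)
    -- the Kronecker product covariance model
    (σ : ι → ℝ) (s : ℝ) (hs : 0 < s) (hσ : ∀ i, s ≤ σ i ^ 2)
    (S : (i : ι) → (j : Fin (v i)) → Matrix (Fin (n i j)) (Fin (n i j)) ℝ)
    (hS : ∀ i j, (S i j).PosSemidef)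
    (hStr : ∀ i j, (S i j).trace = (n i j : ℝ))
    -- the data
    {Ω : ι → Type*} [∀ i, MeasurableSpace (Ω i)] (P : (i : ι) → Measure (Ω i))
    [∀ i, IsProbabilityMeasure (P i)]
    (y : (i : ι) → Fin (T i) → Ω i → KroneckerCov.MultiIdx (n i) → ℝ)
    (hymeas : ∀ i t, Measurable (y i t))
    (μ : (i : ι) → KroneckerCov.MultiIdx (n i) → ℝ)
    (hmean : ∀ i t k, ∫ ω, y i t ω k ∂(P i) = μ i k)
    (hcov : ∀ i t k k', cov[fun ω => y i t ω k, fun ω => y i t ω k'; P i] =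
      KroneckerCov.kronModel (σ i ^ 2) (S i) k k')
    -- independence, moments, kurtosis
    (hindep : ∀ i, iIndepFun (y i) (P i))
    (A : ℝ) (hA : 0 < A) (hmom : ∀ i, KroneckerCov.MomentBound (P i) (y i) A)
    (C : ℝ) (hC : 0 < C)
    (hkurt : ∀ i t, KroneckerCov.KurtosisDominated (P i) (y i t) (μ i)
      (KroneckerCov.kronModel (σ i ^ 2) (S i)) C)
    -- smallest eigenvalues of the factors bounded away from zero
    (c : ℝ) (hc : 0 < c)
    (hlam : ∀ᶠ i in l, ∀ j k, c ≤ (hS i j).isHermitian.eigenvalues k)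
    -- cross-sectional dependence
    (β₁ : ℝ) (hβ0 : 0 ≤ β₁) (hβ2 : β₁ ≤ 2) (w : ℝ)
    (hw : Tendsto (fun i => KroneckerCov.frobNorm (KroneckerCov.kronModel (σ i ^ 2) (S i)) ^ 2 /
      (KroneckerCov.totalDim (n i) : ℝ) ^ β₁) l (𝓝 w))
    -- rate condition
    (hrate : Tendsto (fun i => Real.log (KroneckerCov.totalDim (n i) : ℝ) ^ 3 / (T i : ℝ)) l (𝓝 0)) :
    -- the inverse exists with probability tending to one
    Tendsto (fun i => P i {ω | ¬ IsUnit (KroneckerCov.quadFormEst (fun t => y i t ω))}) l (𝓝 0) ∧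
    -- rates of convergence
    KroneckerCov.IsBigOpSum P l
      (fun i ω => KroneckerCov.relErr KroneckerCov.frobNorm
        (KroneckerCov.quadFormEst (fun t => y i t ω))
        (KroneckerCov.kronModel (σ i ^ 2) (S i)))
      (fun i => KroneckerCov.rateAveraging (KroneckerCov.totalDim (n i)) (T i) β₁)
      (fun i => KroneckerCov.rateCentering (KroneckerCov.totalDim (n i)) (T i)) ∧
    KroneckerCov.IsBigOpSum P l
      (fun i ω => KroneckerCov.relErr KroneckerCov.frobNorm
        (KroneckerCov.quadFormEst (fun t => y i t ω))⁻¹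
        (KroneckerCov.kronModel (σ i ^ 2) (S i))⁻¹)
      (fun i => KroneckerCov.rateAveraging (KroneckerCov.totalDim (n i)) (T i) β₁)
      (fun i => KroneckerCov.rateCentering (KroneckerCov.totalDim (n i)) (T i)) ∧
    KroneckerCov.IsBigOpSum P l
      (fun i ω => KroneckerCov.relErr KroneckerCov.l1Norm
        (KroneckerCov.quadFormEst (fun t => y i t ω))
        (KroneckerCov.kronModel (σ i ^ 2) (S i)))
      (fun i => KroneckerCov.rateAveraging (KroneckerCov.totalDim (n i)) (T i) β₁)
      (fun i => KroneckerCov.rateCentering (KroneckerCov.totalDim (n i)) (T i)) ∧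
    KroneckerCov.IsBigOpSum P l
      (fun i ω => KroneckerCov.relErr KroneckerCov.l1Norm
        (KroneckerCov.quadFormEst (fun t => y i t ω))⁻¹
        (KroneckerCov.kronModel (σ i ^ 2) (S i))⁻¹)
      (fun i => KroneckerCov.rateAveraging (KroneckerCov.totalDim (n i)) (T i) β₁)
      (fun i => KroneckerCov.rateCentering (KroneckerCov.totalDim (n i)) (T i)) ∧
    KroneckerCov.IsBigOpSum P l
      (fun i ω => KroneckerCov.relErr KroneckerCov.specNorm
        (KroneckerCov.quadFormEst (fun t => y i t ω))
        (KroneckerCov.kronModel (σ i ^ 2) (S i)))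
      (fun i => KroneckerCov.rateAveraging (KroneckerCov.totalDim (n i)) (T i) β₁)
      (fun i => KroneckerCov.rateCentering (KroneckerCov.totalDim (n i)) (T i)) ∧
    KroneckerCov.IsBigOpSum P l
      (fun i ω => KroneckerCov.relErr KroneckerCov.specNorm
        (KroneckerCov.quadFormEst (fun t => y i t ω))⁻¹
        (KroneckerCov.kronModel (σ i ^ 2) (S i))⁻¹)
      (fun i => KroneckerCov.rateAveraging (KroneckerCov.totalDim (n i)) (T i) β₁)
      (fun i => KroneckerCov.rateCentering (KroneckerCov.totalDim (n i)) (T i)) ∧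
    -- consistency in relative norm
    KroneckerCov.IsLittleOpOne P l
      (fun i ω => KroneckerCov.relErr KroneckerCov.frobNorm
        (KroneckerCov.quadFormEst (fun t => y i t ω))
        (KroneckerCov.kronModel (σ i ^ 2) (S i))) ∧
    KroneckerCov.IsLittleOpOne P l
      (fun i ω => KroneckerCov.relErr KroneckerCov.frobNorm
        (KroneckerCov.quadFormEst (fun t => y i t ω))⁻¹
        (KroneckerCov.kronModel (σ i ^ 2) (S i))⁻¹) ∧
    KroneckerCov.IsLittleOpOne P l
      (fun i ω => KroneckerCov.relErr KroneckerCov.l1Norm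
        (KroneckerCov.quadFormEst (fun t => y i t ω))
        (KroneckerCov.kronModel (σ i ^ 2) (S i))) ∧
    KroneckerCov.IsLittleOpOne P l
      (fun i ω => KroneckerCov.relErr KroneckerCov.l1Norm
        (KroneckerCov.quadFormEst (fun t => y i t ω))⁻¹
        (KroneckerCov.kronModel (σ i ^ 2) (S i))⁻¹) ∧
    KroneckerCov.IsLittleOpOne P l
      (fun i ω => KroneckerCov.relErr KroneckerCov.specNorm
        (KroneckerCov.quadFormEst (fun t => y i t ω))
        (KroneckerCov.kronModel (σ i ^ 2) (S i))) ∧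
    KroneckerCov.IsLittleOpOne P l
      (fun i ω => KroneckerCov.relErr KroneckerCov.specNorm
        (KroneckerCov.quadFormEst (fun t => y i t ω))⁻¹
        (KroneckerCov.kronModel (σ i ^ 2) (S i))⁻¹) := by
  -- elementary bounds along the regime
  have hlogtop : Tendsto (fun i => Real.log (totalDim (n i) : ℝ)) l atTop := by
    refine tendsto_atTop_mono (fun i => natCast_mul_log_two_le_log_totalDim fun j => (hn i j).1) ?_
    exact (tendsto_natCast_atTop_atTop.comp hv).atTop_mul_const (Real.log_pos one_lt_two)
  have hlog1 : ∀ᶠ i in l, 1 ≤ Real.log (totalDim (n i) : ℝ) := hlogtop.eventually_ge_atTop 1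
  have hT0 : ∀ᶠ i in l, 0 < T i := hT.eventually_gt_atTop 0
  have hv0 : ∀ᶠ i in l, 0 < v i := hv.eventually_gt_atTop 0
  have hd1 : ∀ i, 1 ≤ totalDim (n i) := fun i =>
    Nat.one_le_iff_ne_zero.mpr (Finset.prod_ne_zero_iff.mpr fun j _ => by
      have := (hn i j).1; omega)
  have hFw : ∀ᶠ i in l, frobNorm (kronModel (σ i ^ 2) (S i)) ^ 2 ≤
      (|w| + 1) * (totalDim (n i) : ℝ) ^ β₁ := by
    have h1 : w < |w| + 1 := by linarith [le_abs_self w]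
    filter_upwards [hw.eventually_lt_const h1] with i hi
    have h2 : (0 : ℝ) < totalDim (n i) := by exact_mod_cast hd1 i
    rw [div_lt_iff₀ (by positivity)] at hi
    exact hi.le
  set a : ι → ℝ := fun i => rateAveraging (totalDim (n i)) (T i) β₁ with ha
  set b : ι → ℝ := fun i => rateCentering (totalDim (n i)) (T i) with hb
  have ha0 : ∀ i, 0 ≤ a i := fun i => rateAveraging_nonneg _ _ _
  have hb0 : ∀ i, 0 ≤ b i := fun i => rateCentering_nonneg _ _
  have hr0 : ∀ᶠ i in l, 0 < a i + b i := by
    filter_upwards [hlog1, hT0] with i hi hTi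
    have hTi' : (0 : ℝ) < T i := by exact_mod_cast hTi
    have h1 : 0 < b i := div_pos (by positivity) hTi'
    linarith [ha0 i]
  have hr : Tendsto (fun i => a i + b i) l (𝓝 0) := by
    have h1 : Tendsto (fun i => √(Real.log (totalDim (n i) : ℝ) ^ 3 / (T i : ℝ)) +
        Real.log (totalDim (n i) : ℝ) ^ 3 / (T i : ℝ)) l (𝓝 0) := by
      simpa using hrate.sqrt.add hrate
    refine squeeze_zero' (Eventually.of_forall fun i => add_nonneg (ha0 i) (hb0 i)) ?_ h1
    filter_upwards [hlog1] with i hi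
    exact add_le_add (rateAveraging_le (hd1 i) hβ2) (rateCentering_le hi)
  -- the multiplicative perturbation of the covariance matrix, controlled in expectation
  set K₀ : ℝ := 6 * (N / c + 1) + 1 with hK₀
  have hK₀pos : 0 < K₀ := by positivity
  set K₁ : ℝ := N ^ 3 * (2 * (√(2 * C * (|w| + 1)) / s + 1)) + 1 with hK₁
  have hK₁pos : 0 < K₁ := by positivity
  have core : ∀ᶠ i in l, ∃ X : Ω i → ℝ, Integrable X (P i) ∧ (∀ ω, 0 ≤ X ω) ∧
      ∫ ω, X ω ∂(P i) ≤ K₁ * (a i + b i) ∧ ∀ ω, K₀ * X ω ≤ 1 / 2 →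
        ∃ R, SchurBound R (K₀ * X ω) ∧
          quadFormEst (fun t => y i t ω) = kronModel (σ i ^ 2) (S i) * (1 + R) := by
    filter_upwards [hlog1, hT0, hv0, hFw, hlam] with i hlogi hTi hvi hFi hlami
    have hs2 : 0 < σ i ^ 2 := hs.trans_le (hσ i)
    have hd : (0 : ℝ) < totalDim (n i) := by exact_mod_cast hd1 i
    have hds : 0 < (totalDim (n i) : ℝ) * σ i ^ 2 := mul_pos hd hs2
    obtain ⟨g, hgi, hg0, hg, hgE⟩ := exists_integrable_bound_partialTrace (P := P i) (N := N) hTi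
      (fun j => (hn i j).2) (hymeas i) (posSemidef_kronModel hs2.le (hS i)) (hmean i) (hcov i)
      (hindep i) (fun t k => (hmom i k 4 (by norm_num)).1 t) hC.le (hkurt i)
    have hp : 0 ≤ (N : ℝ) / (totalDim (n i) * σ i ^ 2) := by positivity
    refine ⟨fun ω => N / (totalDim (n i) * σ i ^ 2) * g ω, hgi.const_mul _,
      fun ω => mul_nonneg hp (hg0 ω), ?_, fun ω hω => ?_⟩
    · rw [integral_const_mul]
      refine (mul_le_mul_of_nonneg_left hgE hp).trans ?_
      have hvlog : (v i : ℝ) ≤ 2 * Real.log (totalDim (n i)) := by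
        have h1 := natCast_mul_log_two_le_log_totalDim fun j => (hn i j).1
        have h2 : (1 / 2 : ℝ) ≤ Real.log 2 := by linarith [Real.log_two_gt_d9]
        have h3 : (v i : ℝ) * (1 / 2) ≤ v i * Real.log 2 := by gcongr
        linarith
      have h1 := mul_sqrt_add_le_rates hTi (hd1 i) hlogi hvlog hC.le hs (hσ i)
        (by positivity : 0 ≤ |w| + 1) hFi
      have hrnn : 0 ≤ a i + b i := add_nonneg (ha0 i) (hb0 i)
      rw [trace_kronModel _ (hStr i)]
      have hT' : (T i : ℝ) ≠ 0 := by positivity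
      have hσ0 : σ i ≠ 0 := fun h => by simp [h] at hs2
      calc N / (totalDim (n i) * σ i ^ 2) * (v i * N ^ 2 *
            (√(2 * C * frobNorm (kronModel (σ i ^ 2) (S i)) ^ 2 / T i) +
              totalDim (n i) * σ i ^ 2 / T i))
          = N ^ 3 * (v i * (√(2 * C * frobNorm (kronModel (σ i ^ 2) (S i)) ^ 2 / T i) /
              (totalDim (n i) * σ i ^ 2) + 1 / T i)) := by
            field_simp
        _ ≤ N ^ 3 * (2 * (√(2 * C * (|w| + 1)) / s + 1) * (a i + b i)) := by gcongr
        _ ≤ K₁ * (a i + b i) := by rw [hK₁]; nlinarith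
    · exact exists_quadFormEst_eq_mul_one_add hc hs2 hvi (fun j => by have := (hn i j).1; omega)
        (fun j => (hn i j).2) (fun j => (hS i j).isHermitian) (hStr i) hlami _
        (mul_le_mul_of_nonneg_left (hg ω) hp) hω
  -- the indicator of non-invertibility vanishes wherever `X` is small, so that the domination
  -- argument applies to it as well
  have hunit : IsBigOp P l
      (fun i => {ω | ¬ IsUnit (quadFormEst fun t => y i t ω)}.indicator fun _ => (1 : ℝ))
      fun i => a i + b i := by
    refine isBigOp_of_dominated hK₀pos hK₁pos hr hr0 ?_
    filter_upwards [core, hlam] with i ⟨X, hXi, hX0, hXE, hX⟩ hlami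
    refine ⟨X, hXi, hX0, hXE, fun ω hω => ?_⟩
    obtain ⟨R, hR, hq⟩ := hX ω hω
    have hu : IsUnit (quadFormEst fun t => y i t ω) := by
      rw [hq]
      exact (isUnit_kronModel hc (hs.trans_le (hσ i)) (fun j => (hS i j).isHermitian) hlami).mul
        (hR.isUnit_one_add (by linarith))
    have h0 := hR.nonneg
    rw [Set.indicator_of_notMem (by simpa using hu)]
    simpa using h0
  have herr : ∀ nrm : (i : ι) → Matrix (MultiIdx (n i)) (MultiIdx (n i)) ℝ → ℝ,
      (∀ i, IsSchurIdealNorm (nrm i)) →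
      IsBigOp P l (fun i ω => relErr (nrm i) (quadFormEst fun t => y i t ω)
        (kronModel (σ i ^ 2) (S i))) (fun i => a i + b i) ∧
      IsBigOp P l (fun i ω => relErr (nrm i) (quadFormEst fun t => y i t ω)⁻¹
        (kronModel (σ i ^ 2) (S i))⁻¹) fun i => a i + b i := by
    intro nrm hnrm
    constructor
    · refine isBigOp_of_dominated hK₀pos hK₁pos hr hr0 ?_
      filter_upwards [core] with i ⟨X, hXi, hX0, hXE, hX⟩
      refine ⟨X, hXi, hX0, hXE, fun ω hω => ?_⟩
      obtain ⟨R, hR, hq⟩ := hX ω hω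
      rw [abs_of_nonneg (relErr_nonneg (hnrm i).nonneg _ _)]
      exact (relErr_le_of_eq_mul_one_add (hnrm i) hR hω hq).1
    · refine isBigOp_of_dominated hK₀pos hK₁pos hr hr0 ?_
      filter_upwards [core] with i ⟨X, hXi, hX0, hXE, hX⟩
      refine ⟨X, hXi, hX0, hXE, fun ω hω => ?_⟩
      obtain ⟨R, hR, hq⟩ := hX ω hω
      rw [abs_of_nonneg (relErr_nonneg (hnrm i).nonneg _ _)]
      exact (relErr_le_of_eq_mul_one_add (hnrm i) hR hω hq).2
  obtain ⟨hF, hF'⟩ := herr (fun i => frobNorm) fun i => isSchurIdealNorm_frobNorm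
  obtain ⟨h1, h1'⟩ := herr (fun i => l1Norm) fun i => isSchurIdealNorm_l1Norm
  obtain ⟨hSp, hSp'⟩ := herr (fun i => specNorm) fun i => isSchurIdealNorm_specNorm
  refine ⟨?_, hF.isBigOpSum ha0 hb0 hr0, hF'.isBigOpSum ha0 hb0 hr0, h1.isBigOpSum ha0 hb0 hr0,
    h1'.isBigOpSum ha0 hb0 hr0, hSp.isBigOpSum ha0 hb0 hr0, hSp'.isBigOpSum ha0 hb0 hr0,
    hF.isLittleOpOne hr, hF'.isLittleOpOne hr, h1.isLittleOpOne hr, h1'.isLittleOpOne hr,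
    hSp.isLittleOpOne hr, hSp'.isLittleOpOne hr⟩
  refine ((hunit.isLittleOpOne hr) (1 / 2) (by norm_num)).congr fun i => congrArg _ ?_
  ext ω
  by_cases hω : IsUnit (quadFormEst fun t => y i t ω)
  · simp [hω]
  · simp [hω]; norm_num
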